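/- Let $(X_t)_{t\in\mathbb Z}$ be a strictly stationary real-valued time series, let $m\in\mathbb N$ and $q\ge 1$ be fixed, put $Y_t=(X_t,\dots,X_{t+m-1})'$ and let $F_m$ be the law of $Y_t$. Let $T$ be an $\mathbb R^q$-valued functional of distributions on $\mathbb R^m$, let $\theta=T(F_m)$, $\rho_m^N=N^{-1}\sum_{t=1}^N\delta_{Y_t}$ and $\hat\theta_N=T(\rho_m^N)$ (assumed to be random vectors), and suppose that the influence function $$IF(y;F_m)=\lim_{\varepsilon\downarrow0}\varepsilon^{-1}\bigl[T\{(1-\varepsilon)F_m+\varepsilon\delta_y\}-T(F_m)\bigr]$$ exists for $F_m$-almost every $y$. Define the remainder $R_N$ by $\hat\theta_N=\theta+N^{-1}\sum_{t=1}^N IF(Y_t;F_m)+R_N$. Let $B_q$ be a vector of $q$ independent standard Brownian motions. Assume: 1. $E\{IF(Y_t;F_m)\}=0$, and there is a lower triangular $q\times q$ matrix $\Delta$ with nonnegative diagonal entries such that $\Delta\Delta'$ is positive definite and $$N^{-1/2}\sum_{t=1}^{\lfloor rN\rfloor}IF(Y_t;F_m)\Rightarrow\Delta B_q(r)$$ weakly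 in the space $D[0,1]$ of $\mathbb R^q$-valued càdlàg functions with the Skorokhod topology. 2. $R_N=o_p(N^{-1/2})$ and $N^{-2}\sum_{t=1}^N|tR_t|^2=o_p(1)$. Let $W_N=N^{-2}\sum_{t=1}^N t^2(\hat\theta_t-\hat\theta_N)(\hat\theta_t-\hat\theta_N)'$, $V_q=\int_0^1\{B_q(r)-rB_q(1)\}\{B_q(r)-rB_q(1)\}'\,dr$ and $U_q=B_q(1)'V_q^{-1}B_q(1)$. Then $V_q$ is almost surely invertible, $W_N$ is invertible with probability tending to one, and, with the inverse of a singular matrix read as $0$, $$N(\hat\theta_N-\theta)'W_N^{-1}(\hat\theta_N-\theta)\to_D U_q .$$ Moreover, for every $\alpha\in(0,1)$, with $U_{q,\alpha}$ the $100(1-\alpha)$th percentile of the distribution of $U_q$ (its $(1-\alpha)$-quantile), the confidence region $$\{\vartheta\in\mathbb R^q: N(\hat\theta_N-\vartheta)'W_N^{-1}(\hat\theta_N-\vartheta)\le U_{q,\alpha}\}$$ contains $\theta$ with probability tending to $1-\alpha$ as $N\to\infty$. -/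

import Mathlib

open MeasureTheory ProbabilityTheory Filter Topology Set
open scoped NNReal ENNReal unitInterval

noncomputable section

/-! ### The Skorokhod space of càdlàg functions on `[0, 1]` -/

/-- `f : [0, 1] → E` is right continuous and has left limits at every point. -/
def IsCadlag {E : Type*} [TopologicalSpace E] (f : I → E) : Prop :=
  ∀ r : I, ContinuousWithinAt f (Ici r) r ∧ ∃ l : E, Tendsto f (𝓝[<] r) (𝓝 l)

/-- The space `D[0, 1]` of `E`-valued càdlàg functions on `[0, 1]`. -/
structure SkorokhodSpace (E : Type*) [TopologicalSpace E] where
  toFun : I → E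
  isCadlag : IsCadlag toFun

namespace SkorokhodSpace

variable {E : Type*}

/-- The Skorokhod distance: the infimum over all time changes `lam` (increasing bijections of
`[0, 1]`) of the larger one of `sup |lam t - t|` and `sup dist (x t) (y (lam t))`. -/
instance [PseudoEMetricSpace E] : EDist (SkorokhodSpace E) where
  edist x y := ⨅ lam : I ≃o I,
    max (⨆ t : I, edist (lam t) t) (⨆ t : I, edist (x.toFun t) (y.toFun (lam t)))

theorem edist_def [PseudoEMetricSpace E] (x y : SkorokhodSpace E) :
    edist x y = ⨅ lam : I ≃o I,
      max (⨆ t : I, edist (lam t) t) (⨆ t : I, edist (x.toFun t) (y.toFun (lam t))) := rfl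

theorem edist_comm_le [PseudoEMetricSpace E] (x y : SkorokhodSpace E) :
    edist x y ≤ edist y x := by
  rw [edist_def y x]
  refine le_iInf fun lam => ?_
  rw [edist_def x y]
  refine (iInf_le _ lam.symm).trans ?_
  refine max_le_max ?_ ?_
  · refine iSup_le fun t => ?_
    refine le_trans ?_ (le_iSup (fun t : I => edist (lam t) t) (lam.symm t))
    simp [edist_comm]
  · refine iSup_le fun t => ?_
    refine le_trans ?_
      (le_iSup (fun t : I => edist (y.toFun t) (x.toFun (lam t))) (lam.symm t))
    simp [edist_comm]

instance [PseudoEMetricSpace E] : PseudoEMetricSpace (SkorokhodSpace E) where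
  edist_self x := by
    refine le_antisymm ?_ zero_le
    rw [edist_def]
    refine (iInf_le _ (OrderIso.refl I)).trans ?_
    simp
  edist_comm x y := le_antisymm (edist_comm_le x y) (edist_comm_le y x)
  edist_triangle x y z := by
    rw [edist_def x y, edist_def y z, ENNReal.iInf_add]
    refine le_iInf fun lam => ?_
    rw [ENNReal.add_iInf]
    refine le_iInf fun mu => ?_
    rw [edist_def x z]
    refine (iInf_le _ (lam.trans mu)).trans ?_
    refine max_le ?_ ?_
    · refine iSup_le fun t => ?_
      refine (edist_triangle _ (lam t) t).trans ?_
      rw [add_comm]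
      refine add_le_add (le_max_of_le_left ?_) (le_max_of_le_left ?_)
      · exact le_iSup (fun t : I => edist (lam t) t) t
      · exact le_iSup (fun t : I => edist (mu t) t) (lam t)
    · refine iSup_le fun t => ?_
      refine (edist_triangle _ (y.toFun (lam t)) _).trans ?_
      refine add_le_add (le_max_of_le_right ?_) (le_max_of_le_right ?_)
      · exact le_iSup (fun t : I => edist (x.toFun t) (y.toFun (lam t))) t
      · exact le_iSup (fun t : I => edist (y.toFun t) (z.toFun (mu t))) (lam t)

/-- `D[0, 1]` carries the Borel σ-algebra of the Skorokhod topology. -/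
instance [PseudoEMetricSpace E] : MeasurableSpace (SkorokhodSpace E) := borel _

instance [PseudoEMetricSpace E] : BorelSpace (SkorokhodSpace E) := ⟨rfl⟩

open Classical in
/-- The function `f` as an element of `D[0, 1]`; the zero path if `f` is not càdlàg. -/
def ofFun [TopologicalSpace E] [Zero E] (f : I → E) : SkorokhodSpace E :=
  if h : IsCadlag f then ⟨f, h⟩
  else ⟨fun _ => 0, fun _ => ⟨continuousWithinAt_const, 0, tendsto_const_nhds⟩⟩

end SkorokhodSpace

/-- A function of `⌊r N⌋` is càdlàg in `r`. -/
theorem isCadlag_floor {E : Type*} [TopologicalSpace E] (g : ℕ → E) (N : ℕ) :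
    IsCadlag (fun r : I => g ⌊(r : ℝ) * N⌋₊) := by
  intro r
  have hc : Tendsto (fun s : I => (s : ℝ) * N) (𝓝 r) (𝓝 ((r : ℝ) * N)) :=
    (by fun_prop : Continuous (fun s : I => (s : ℝ) * N)).tendsto r
  constructor
  · refine tendsto_const_nhds.congr' ?_
    have h1 : ∀ᶠ s : I in 𝓝[≥] r, (s : ℝ) * N < ⌊(r : ℝ) * N⌋₊ + 1 :=
      (hc.mono_left nhdsWithin_le_nhds).eventually_lt_const (Nat.lt_floor_add_one _)
    filter_upwards [h1, self_mem_nhdsWithin] with s hs hrs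
    congr 1
    have h2 : (r : ℝ) * N ≤ (s : ℝ) * N :=
      mul_le_mul_of_nonneg_right hrs (Nat.cast_nonneg N)
    have h3 : 0 ≤ (s : ℝ) * N := mul_nonneg s.2.1 (Nat.cast_nonneg N)
    refine le_antisymm (Nat.floor_mono h2) ?_
    have : ⌊(s : ℝ) * N⌋₊ < ⌊(r : ℝ) * N⌋₊ + 1 := (Nat.floor_lt h3).2 (by exact_mod_cast hs)
    omega
  · refine ⟨g (⌈(r : ℝ) * N⌉₊ - 1), tendsto_const_nhds.congr' ?_⟩
    have h1 : ∀ᶠ s : I in 𝓝[<] r, 0 < ⌈(r : ℝ) * N⌉₊ →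
        ((⌈(r : ℝ) * N⌉₊ - 1 : ℕ) : ℝ) < (s : ℝ) * N := by
      by_cases h0 : 0 < ⌈(r : ℝ) * N⌉₊
      · have : ((⌈(r : ℝ) * N⌉₊ - 1 : ℕ) : ℝ) < (r : ℝ) * N :=
          Nat.lt_ceil.1 (by omega)
        exact ((hc.mono_left nhdsWithin_le_nhds).eventually_const_lt this).mono fun s hs _ => hs
      · exact Eventually.of_forall fun s h => absurd h h0
    filter_upwards [h1, self_mem_nhdsWithin] with s hs hsr
    congr 1
    have h3 : 0 ≤ (s : ℝ) * N := mul_nonneg s.2.1 (Nat.cast_nonneg N)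
    rcases Nat.eq_zero_or_pos N with hN | hN
    · subst hN
      simp
    · have hsr' : (s : ℝ) < r := hsr
      have h2 : (s : ℝ) * N < (r : ℝ) * N :=
        mul_lt_mul_of_pos_right hsr' (by exact_mod_cast hN)
      have h4 : 0 < ⌈(r : ℝ) * N⌉₊ := Nat.ceil_pos.2 (h3.trans_lt h2)
      have h5 : ⌊(s : ℝ) * N⌋₊ < ⌈(r : ℝ) * N⌉₊ := by
        have : (⌊(s : ℝ) * N⌋₊ : ℝ) < ⌈(r : ℝ) * N⌉₊ :=
          ((Nat.floor_le h3).trans_lt h2).trans_le (Nat.le_ceil _)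
        exact_mod_cast this
      have h6 : ⌈(r : ℝ) * N⌉₊ - 1 ≤ ⌊(s : ℝ) * N⌋₊ := Nat.le_floor (hs h4).le
      omega

/-! ### The time series, the functional and its estimators -/

/-- `(X_t)` is a strictly stationary time series: the law of the whole process is invariant under
all shifts of time. -/
structure IsStrictlyStationary {Ω : Type*} [MeasurableSpace Ω] (X : ℤ → Ω → ℝ) (P : Measure Ω) :
    Prop where
  measurable : ∀ t, Measurable (X t)
  map_shift : ∀ k : ℤ, P.map (fun ω t => X (t + k) ω) = P.map (fun ω t => X t ω)

/-- `Y_t = (X_t, …, X_{t+m-1})`. -/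
def lagVector {Ω : Type*} (X : ℤ → Ω → ℝ) (m : ℕ) (t : ℤ) (ω : Ω) : Fin m → ℝ :=
  fun i => X (t + (i : ℕ)) ω

/-- The marginal distribution `F_m` of `Y_t` (for a stationary series the same for every `t`). -/
def marginalLaw {Ω : Type*} [MeasurableSpace Ω] (X : ℤ → Ω → ℝ) (m : ℕ) (P : Measure Ω) :
    Measure (Fin m → ℝ) :=
  P.map (lagVector X m 0)

/-- The empirical distribution `ρ_m^N = N⁻¹ ∑_{t=1}^N δ_{Y_t}` (the zero measure for `N = 0`). -/
def empiricalLaw {Ω : Type*} (X : ℤ → Ω → ℝ) (m N : ℕ) (ω : Ω) : Measure (Fin m → ℝ) :=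
  (N : ℝ≥0∞)⁻¹ • ∑ t ∈ Finset.Icc 1 N, Measure.dirac (lagVector X m (t : ℤ) ω)

section Functional

variable {Ω : Type*} {m q : ℕ}

/-- The estimator `θ̂_N = T(ρ_m^N)`. -/
def estimator (T : Measure (Fin m → ℝ) → EuclideanSpace ℝ (Fin q)) (X : ℤ → Ω → ℝ)
    (N : ℕ) (ω : Ω) : EuclideanSpace ℝ (Fin q) :=
  T (empiricalLaw X m N ω)

/-- `psi` is the influence function `IF(·; F)` of `T` at `F`:
`IF(y; F) = lim_{ε ↓ 0} (T((1 - ε) F + ε δ_y) - T(F)) / ε` for `F`-almost every `y`. -/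
def IsInfluenceFunction (T : Measure (Fin m → ℝ) → EuclideanSpace ℝ (Fin q))
    (F : Measure (Fin m → ℝ)) (psi : (Fin m → ℝ) → EuclideanSpace ℝ (Fin q)) : Prop :=
  ∀ᵐ y ∂F, Tendsto
    (fun ε : ℝ =>
      ε⁻¹ • (T (ENNReal.ofReal (1 - ε) • F + ENNReal.ofReal ε • Measure.dirac y) - T F))
    (𝓝[>] 0) (𝓝 (psi y))

/-- The remainder `R_N = θ̂_N - T(F) - N⁻¹ ∑_{t=1}^N IF(Y_t; F)` of the linear expansion. -/
def remainder (T : Measure (Fin m → ℝ) → EuclideanSpace ℝ (Fin q)) (F : Measure (Fin m → ℝ))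
    (psi : (Fin m → ℝ) → EuclideanSpace ℝ (Fin q)) (X : ℤ → Ω → ℝ) (N : ℕ) (ω : Ω) :
    EuclideanSpace ℝ (Fin q) :=
  estimator T X N ω - T F - (N : ℝ)⁻¹ • ∑ t ∈ Finset.Icc 1 N, psi (lagVector X m (t : ℤ) ω)

/-- The path `r ↦ N^{-1/2} ∑_{t=1}^{⌊rN⌋} IF(Y_t; F)` as an element of `D[0, 1]`. -/
def partialSumPath (psi : (Fin m → ℝ) → EuclideanSpace ℝ (Fin q)) (X : ℤ → Ω → ℝ) (N : ℕ)
    (ω : Ω) : SkorokhodSpace (EuclideanSpace ℝ (Fin q)) where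
  toFun r := (√(N : ℝ))⁻¹ •
    ∑ t ∈ Finset.Icc 1 ⌊(r : ℝ) * N⌋₊, psi (lagVector X m (t : ℤ) ω)
  isCadlag := isCadlag_floor
    (fun k => (√(N : ℝ))⁻¹ • ∑ t ∈ Finset.Icc 1 k, psi (lagVector X m (t : ℤ) ω)) N

/-- `W_N = N⁻² ∑_{t=1}^N t² (θ̂_t - θ̂_N)(θ̂_t - θ̂_N)'`. -/
def selfNormalizer (T : Measure (Fin m → ℝ) → EuclideanSpace ℝ (Fin q)) (X : ℤ → Ω → ℝ)
    (N : ℕ) (ω : Ω) : Matrix (Fin q) (Fin q) ℝ :=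
  ((N : ℝ) ^ 2)⁻¹ • ∑ t ∈ Finset.Icc 1 N, (t : ℝ) ^ 2 •
    Matrix.vecMulVec (estimator T X t ω - estimator T X N ω).ofLp
      (estimator T X t ω - estimator T X N ω).ofLp

/-- `N (θ̂_N - ϑ)' W_N⁻¹ (θ̂_N - ϑ)`. -/
def snStatistic (T : Measure (Fin m → ℝ) → EuclideanSpace ℝ (Fin q)) (X : ℤ → Ω → ℝ)
    (ϑ : EuclideanSpace ℝ (Fin q)) (N : ℕ) (ω : Ω) : ℝ :=
  N * ((estimator T X N ω - ϑ).ofLp ⬝ᵥ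
    Matrix.mulVec (selfNormalizer T X N ω)⁻¹ (estimator T X N ω - ϑ).ofLp)

/-- The random set `{ϑ : N (θ̂_N - ϑ)' W_N⁻¹ (θ̂_N - ϑ) ≤ c}`. -/
def confidenceRegion (T : Measure (Fin m → ℝ) → EuclideanSpace ℝ (Fin q)) (X : ℤ → Ω → ℝ)
    (c : ℝ) (N : ℕ) (ω : Ω) : Set (EuclideanSpace ℝ (Fin q)) :=
  {ϑ | snStatistic T X ϑ N ω ≤ c}

end Functional

/-! ### Brownian motion and the limit variable -/

section Limit

variable {Ω' : Type*} {q : ℕ}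

/-- A `q`-dimensional vector of independent standard Brownian motions. -/
structure IsBrownianVector [MeasurableSpace Ω'] (B : Fin q → ℝ≥0 → Ω' → ℝ) (Q : Measure Ω') :
    Prop where
  isBrownian : ∀ i, IsBrownianReal (B i) Q
  indep : iIndepFun (fun i ω t => B i t ω) Q

/-- `B_q(r)` as a vector. -/
def brownianVec (B : Fin q → ℝ≥0 → Ω' → ℝ) (r : ℝ) (ω : Ω') : Fin q → ℝ :=
  fun i => B i r.toNNReal ω

/-- The path `r ↦ Δ B_q(r)` as an element of `D[0, 1]` (the zero path on the null event where
it is not càdlàg). -/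
def limitPath (Δ : Matrix (Fin q) (Fin q) ℝ) (B : Fin q → ℝ≥0 → Ω' → ℝ) (ω : Ω') :
    SkorokhodSpace (EuclideanSpace ℝ (Fin q)) :=
  SkorokhodSpace.ofFun fun r : I => WithLp.toLp 2 (Matrix.mulVec Δ (brownianVec B r ω))

/-- `V_q = ∫_0^1 (B_q(r) - r B_q(1))(B_q(r) - r B_q(1))' dr`. -/
def bridgeGram (B : Fin q → ℝ≥0 → Ω' → ℝ) (ω : Ω') : Matrix (Fin q) (Fin q) ℝ :=
  Matrix.of fun i j => ∫ r in (0 : ℝ)..1,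
    (brownianVec B r ω i - r * brownianVec B 1 ω i) *
      (brownianVec B r ω j - r * brownianVec B 1 ω j)

/-- `U_q = B_q(1)' V_q⁻¹ B_q(1)`. -/
def pivot (B : Fin q → ℝ≥0 → Ω' → ℝ) (ω : Ω') : ℝ :=
  brownianVec B 1 ω ⬝ᵥ Matrix.mulVec (bridgeGram B ω)⁻¹ (brownianVec B 1 ω)

end Limit

/-- The `100 p`th percentile of a probability distribution on `ℝ`. -/
def percentile (μ : Measure ℝ) (p : ℝ) : ℝ :=
  sInf {x : ℝ | p ≤ μ.real (Iic x)}

end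

/-!
The statistic is a continuous function of a pair for which the functional central limit theorem
gives a joint limit, and the unknown matrix `Δ` cancels in that limit.

Write `S_N(r)` for the partial sum path. The linear expansion shows that
`(√N (θ̂_N - θ), W_N)` differs from the endpoint of `S_N` and the Gram matrix of its bridge
`S_N(r) - r S_N(1)` over the grid `t / N` by at most a quantity that vanishes with the two
remainder sizes (`norm_errorPair_sub_le`, by Cauchy-Schwarz). The grid functionals converge
continuously, at every continuous path, to the endpoint and the Gram matrix of the bridge in
`L²[0, 1]` (`SkorokhodSpace.tendsto_gridEndGram`): near a continuous path the Skorokhod topology is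
uniform, and Riemann sums of continuous functions converge. The limit path is almost surely
continuous, so an extended continuous mapping theorem
(`MeasureTheory.TendstoInDistribution.comp_of_tendsto_prod`) and Slutsky's theorem give the joint
limit `(Δ B(1), Δ V Δ')` (`tendstoInDistribution_errorPair`). The map `(v, M) ↦ v' M⁻¹ v` is
continuous where `M` is invertible and takes the same value at `(Δ B(1), Δ V Δ')` as at
`(B(1), V)`.

Two facts about Brownian motion remain. First, `V` is almost surely positive definite
(`IsBrownianVector.ae_posDef_bridgeGram`): otherwise some nontrivial combination of the bridges
vanishes identically, which forces a determinant in the increments over `q + 1` intervals of equal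
length to vanish; that determinant is a nonzero polynomial in independent Gaussian variables.
Second, the law of the pivot has no atoms (`IsBrownianVector.nullSingletonClass_pivot`): one
endpoint `B_i(1)` is independent of all bridges and of the other endpoints, and given those the
pivot is a quadratic polynomial in `B_i(1)` with leading coefficient `(V⁻¹)ᵢᵢ > 0`. Hence its
distribution function is continuous, equals `1 - α` at the percentile, and the coverage
probabilities converge.
-/

/-! ### Weak convergence -/

section WeakConvergence

variable {Ω Ω' E F : Type*} [MeasurableSpace Ω] [MeasurableSpace Ω'] {P : Measure Ω}
  {Q : Measure Ω'} [IsProbabilityMeasure P] [IsProbabilityMeasure Q]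
  [MeasurableSpace E] [MeasurableSpace F]

theorem limsup_measure_preimage_le [TopologicalSpace E] [OpensMeasurableSpace E]
    [HasOuterApproxClosed E] {X : ℕ → Ω → E} {Z : Ω' → E}
    (h : TendstoInDistribution X atTop Z (fun _ => P) Q) {C : Set E} (hC : IsClosed C) :
    limsup (fun n => P (X n ⁻¹' C)) atTop ≤ Q (Z ⁻¹' C) := by
  have := ProbabilityMeasure.limsup_measure_closed_le_of_tendsto h.tendsto hC
  simp only [ProbabilityMeasure.coe_mk] at this
  rw [Measure.map_apply_of_aemeasurable h.aemeasurable_limit hC.measurableSet] at this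
  simpa only [Measure.map_apply_of_aemeasurable (h.forall_aemeasurable _) hC.measurableSet]
    using this

/-- A closed set that the limit almost surely avoids is asymptotically avoided. -/
theorem tendsto_measure_preimage_zero [TopologicalSpace E] [OpensMeasurableSpace E]
    [HasOuterApproxClosed E] {X : ℕ → Ω → E} {Z : Ω' → E}
    (h : TendstoInDistribution X atTop Z (fun _ => P) Q) {C : Set E} (hC : IsClosed C)
    (h0 : Q (Z ⁻¹' C) = 0) :
    Tendsto (fun n => P (X n ⁻¹' C)) atTop (𝓝 0) := by
  refine tendsto_of_le_liminf_of_limsup_le zero_le ?_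
  exact (limsup_measure_preimage_le h hC).trans h0.le

/-- The extended continuous mapping theorem: if `X n` converges in distribution to `Z` and the
functionals `h n` converge continuously to `g` at almost every value of `Z`, then `h n (X n)`
converges in distribution to `g Z`. -/
theorem MeasureTheory.TendstoInDistribution.comp_of_tendsto_prod [TopologicalSpace E]
    [OpensMeasurableSpace E] [HasOuterApproxClosed E] [PseudoEMetricSpace F] [BorelSpace F]
    {X : ℕ → Ω → E} {Z : Ω' → E} (hX : TendstoInDistribution X atTop Z (fun _ => P) Q)
    {h : ℕ → E → F} {g : E → F} (hm : ∀ n, AEMeasurable (fun ω => h n (X n ω)) P)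
    (hg : AEMeasurable (fun ω => g (Z ω)) Q)
    (hc : ∀ᵐ ω ∂Q, Tendsto (fun p : ℕ × E => h p.1 p.2) (atTop ×ˢ 𝓝 (Z ω)) (𝓝 (g (Z ω)))) :
    TendstoInDistribution (fun n ω => h n (X n ω)) atTop (fun ω => g (Z ω)) (fun _ => P) Q := by
  refine ⟨hm, hg, tendsto_of_forall_isClosed_limsup_le' fun C hC => ?_⟩
  simp only [ProbabilityMeasure.coe_mk]
  rw [Measure.map_apply_of_aemeasurable hg hC.measurableSet]
  simp only [Measure.map_apply_of_aemeasurable (hm _) hC.measurableSet]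
  -- The closed sets `A k` decrease, and their intersection is carried into `C` by `g`.
  set A : ℕ → Set E := fun k => closure (⋃ n ≥ k, h n ⁻¹' C) with hA
  have hAc : ∀ k, IsClosed (A k) := fun k => isClosed_closure
  have hanti : Antitone A := fun k l hkl => closure_mono <|
    biUnion_subset_biUnion_left fun n (hn : l ≤ n) => hkl.trans hn
  have h1 : ∀ k, limsup (fun n => P ((fun ω => h n (X n ω)) ⁻¹' C)) atTop ≤ Q (Z ⁻¹' A k) := by
    intro k
    refine le_trans (limsup_le_limsup ?_) (limsup_measure_preimage_le hX (hAc k))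
    filter_upwards [eventually_ge_atTop k] with n hn
    refine measure_mono fun ω hω => subset_closure ?_
    exact mem_biUnion (show n ∈ {n | n ≥ k} from hn) hω
  have h2 : Tendsto (fun k => Q (Z ⁻¹' A k)) atTop (𝓝 (Q (⋂ k, Z ⁻¹' A k))) := by
    refine tendsto_measure_iInter_atTop
      (fun k => hX.aemeasurable_limit.nullMeasurableSet_preimage (hAc k).measurableSet)
      (fun k l hkl => preimage_mono (hanti hkl)) ⟨0, measure_ne_top _ _⟩
  refine (ge_of_tendsto' h2 h1).trans (measure_mono_ae ?_)
  filter_upwards [hc] with ω hω hmem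
  by_contra hnot
  have h3 : ∀ᶠ p : ℕ × E in atTop ×ˢ 𝓝 (Z ω), h p.1 p.2 ∈ Cᶜ :=
    hω (hC.isOpen_compl.mem_nhds hnot)
  obtain ⟨pa, hpa, pb, hpb, hp⟩ := eventually_prod_iff.1 h3
  obtain ⟨k, hk⟩ := eventually_atTop.1 hpa
  obtain ⟨y, hy, hyC⟩ := mem_closure_iff_nhds.1 (mem_iInter.1 hmem k) _ hpb
  obtain ⟨n, hn, hnC⟩ := mem_iUnion₂.1 hyC
  exact hp (hk n hn) hy hnC

/-- The continuous mapping theorem for a map that is continuous at almost every value of the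
limit. -/
theorem MeasureTheory.TendstoInDistribution.comp_of_continuousAt [TopologicalSpace E]
    [OpensMeasurableSpace E] [HasOuterApproxClosed E] [PseudoEMetricSpace F] [BorelSpace F]
    {X : ℕ → Ω → E} {Z : Ω' → E} (hX : TendstoInDistribution X atTop Z (fun _ => P) Q)
    {g : E → F} (hg : Measurable g) (hc : ∀ᵐ ω ∂Q, ContinuousAt g (Z ω)) :
    TendstoInDistribution (fun n ω => g (X n ω)) atTop (fun ω => g (Z ω)) (fun _ => P) Q := by
  refine hX.comp_of_tendsto_prod (h := fun _ => g)
    (fun n => hg.comp_aemeasurable (hX.forall_aemeasurable n))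
    (hg.comp_aemeasurable hX.aemeasurable_limit) ?_
  filter_upwards [hc] with ω hω
  exact hω.tendsto.comp tendsto_snd

/-- Convergence in distribution to a constant implies convergence in measure. -/
theorem MeasureTheory.TendstoInDistribution.tendstoInMeasure_const
    [SeminormedAddCommGroup E] [OpensMeasurableSpace E]
    {X : ℕ → Ω → E} {c : E}
    (h : TendstoInDistribution X atTop (fun _ : Ω' => c) (fun _ => P) Q) :
    TendstoInMeasure P X atTop (fun _ => c) := by
  rw [tendstoInMeasure_iff_norm]
  intro ε hε
  refine tendsto_measure_preimage_zero h (C := {x | ε ≤ ‖x - c‖})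
    (isClosed_le continuous_const (by fun_prop)) ?_
  simp [hε.not_ge]

end WeakConvergence

/-! ### Quantiles of atomless laws -/

theorem continuous_measureReal_Iic (μ : Measure ℝ) [IsProbabilityMeasure μ] [NullSingletonClass μ] :
    Continuous fun x => μ.real (Iic x) := by
  have h : (fun x => μ.real (Iic x)) = cdf μ := by
    ext x; exact (cdf_eq_real μ x).symm
  rw [h]
  refine continuous_iff_continuousAt.2 fun x => ?_
  rw [(monotone_cdf μ).continuousAt_iff_leftLim_eq_rightLim, StieltjesFunction.rightLim_eq]
  have h1 : (cdf μ).measure {x} = 0 := by rw [measure_cdf]; simp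
  rw [StieltjesFunction.measure_singleton, ENNReal.ofReal_eq_zero] at h1
  exact le_antisymm ((monotone_cdf μ).leftLim_le le_rfl) (by linarith)

theorem measureReal_Iic_percentile (μ : Measure ℝ) [IsProbabilityMeasure μ]
    [NullSingletonClass μ] {p : ℝ} (hp0 : 0 < p) (hp1 : p < 1) :
    μ.real (Iic (percentile μ p)) = p := by
  set F : ℝ → ℝ := fun x => μ.real (Iic x) with hF
  have hcont : Continuous F := continuous_measureReal_Iic μ
  have hFcdf : F = cdf μ := by ext x; exact (cdf_eq_real μ x).symm
  have hmono : Monotone F := hFcdf ▸ monotone_cdf μ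
  have hclosed : IsClosed {x | p ≤ F x} := isClosed_le continuous_const hcont
  have hne : {x | p ≤ F x}.Nonempty := by
    have : Tendsto F atTop (𝓝 1) := hFcdf ▸ tendsto_cdf_atTop μ
    obtain ⟨x, hx⟩ := (this.eventually_const_lt hp1).exists
    exact ⟨x, hx.le⟩
  have hbdd : BddBelow {x | p ≤ F x} := by
    have : Tendsto F atBot (𝓝 0) := hFcdf ▸ tendsto_cdf_atBot μ
    obtain ⟨b, hb⟩ := (this.eventually_lt_const hp0).exists
    refine ⟨b, fun x (hx : p ≤ F x) => ?_⟩
    by_contra hlt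
    have := hmono (not_le.1 hlt).le
    linarith
  refine le_antisymm ?_ (hclosed.csInf_mem hne hbdd)
  have hev : ∀ᶠ x in 𝓝[<] (percentile μ p), F x ≤ p := by
    filter_upwards [self_mem_nhdsWithin] with x hx
    by_contra hlt
    exact (notMem_of_lt_csInf hx hbdd) (not_le.1 hlt).le
  exact le_of_tendsto (hcont.continuousWithinAt (s := Iio _)) hev

/-! ### Riemann sums and inverse quadratic forms -/

theorem tendsto_riemannSum {g : ℝ → ℝ} (hg : Continuous g) :
    Tendsto (fun N : ℕ => (N : ℝ)⁻¹ * ∑ t ∈ Finset.Icc 1 N, g (t / N)) atTop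
      (𝓝 (∫ r in (0 : ℝ)..1, g r)) := by
  rw [Metric.tendsto_atTop]
  intro ε hε
  have huc := isCompact_Icc.uniformContinuousOn_of_continuous (hg.continuousOn (s := Icc (0 : ℝ) 1))
  obtain ⟨δ, hδ, hd⟩ := Metric.uniformContinuousOn_iff.1 huc (ε / 2) (half_pos hε)
  obtain ⟨N₀, hN₀⟩ := exists_nat_gt (1 / δ)
  refine ⟨N₀ + 1, fun N hN => ?_⟩
  have hNpos : (0 : ℝ) < N := by exact_mod_cast (by omega : 0 < N)
  have hNδ : 1 / (N : ℝ) < δ := by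
    rw [div_lt_comm₀ hNpos hδ]
    exact hN₀.trans (by exact_mod_cast hN)
  have hsplit : ∫ r in (0 : ℝ)..1, g r =
      ∑ k ∈ Finset.range N, ∫ r in ((k : ℕ) / N : ℝ)..((k + 1 : ℕ) / N : ℝ), g r := by
    rw [intervalIntegral.sum_integral_adjacent_intervals (a := fun k : ℕ => (k / N : ℝ))
      fun k _ => hg.intervalIntegrable _ _]
    simp [hNpos.ne']
  have hsum : (N : ℝ)⁻¹ * ∑ t ∈ Finset.Icc 1 N, g (t / N) =
      ∑ k ∈ Finset.range N, (N : ℝ)⁻¹ * g ((k + 1 : ℕ) / N) := by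
    rw [Finset.mul_sum, Finset.range_eq_Ico, Finset.sum_Ico_add'
      (fun k : ℕ => (N : ℝ)⁻¹ * g ((k : ℕ) / N)) 0 N 1]
    rfl
  rw [hsum, hsplit, Real.dist_eq, ← Finset.sum_sub_distrib]
  have hterm : ∀ k ∈ Finset.range N, |(N : ℝ)⁻¹ * g ((k + 1 : ℕ) / N)
      - ∫ r in ((k : ℕ) / N : ℝ)..((k + 1 : ℕ) / N : ℝ), g r| ≤ ε / 2 * (N : ℝ)⁻¹ := by
    intro k hk
    have hkN : ((k + 1 : ℕ) : ℝ) ≤ N := by exact_mod_cast Finset.mem_range.1 hk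
    have hlen : ((k + 1 : ℕ) / N : ℝ) - (k : ℕ) / N = (N : ℝ)⁻¹ := by
      push_cast; field_simp; ring
    have hle : ((k : ℕ) / N : ℝ) ≤ (k + 1 : ℕ) / N := by
      have := inv_pos.2 hNpos
      linarith
    have hconst : (N : ℝ)⁻¹ * g ((k + 1 : ℕ) / N) =
        ∫ r in ((k : ℕ) / N : ℝ)..((k + 1 : ℕ) / N : ℝ), g ((k + 1 : ℕ) / N) := by
      rw [intervalIntegral.integral_const, hlen, smul_eq_mul]
    rw [hconst, ← intervalIntegral.integral_sub (by simp) (hg.intervalIntegrable _ _),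
      ← Real.norm_eq_abs]
    refine (intervalIntegral.norm_integral_le_of_norm_le_const (C := ε / 2) ?_).trans ?_
    · intro r hr
      rw [uIoc_of_le hle] at hr
      have h1 : ((k + 1 : ℕ) / N : ℝ) ≤ 1 := div_le_one_of_le₀ hkN hNpos.le
      have h0 : (0 : ℝ) ≤ (k : ℕ) / N := by positivity
      refine (hd _ ⟨h0.trans hle, h1⟩ r ⟨h0.trans hr.1.le, hr.2.trans h1⟩ ?_).le
      rw [Real.dist_eq, abs_of_nonneg (by linarith [hr.2])]
      rw [one_div] at hNδ
      linarith [hr.1]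
    · rw [hlen, abs_of_pos (inv_pos.2 hNpos)]
  calc |∑ k ∈ Finset.range N, ((N : ℝ)⁻¹ * g ((k + 1 : ℕ) / N)
        - ∫ r in ((k : ℕ) / N : ℝ)..((k + 1 : ℕ) / N : ℝ), g r)|
      ≤ ∑ k ∈ Finset.range N, ε / 2 * (N : ℝ)⁻¹ :=
        (Finset.abs_sum_le_sum_abs _ _).trans (Finset.sum_le_sum hterm)
    _ = ε / 2 := by
        rw [Finset.sum_const, Finset.card_range, nsmul_eq_mul]
        field_simp
    _ < ε := half_lt_self hε

section InvQuad

variable {q : ℕ}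

/-- The inverse quadratic form `v' M⁻¹ v` as a function of the pair `(v, M)`, with the inverse of a
singular matrix read as `0`. -/
noncomputable def invQuad (p : (Fin q → ℝ) × (Fin q → Fin q → ℝ)) : ℝ :=
  p.1 ⬝ᵥ Matrix.mulVec (Matrix.of p.2)⁻¹ p.1

theorem continuous_det_of : Continuous fun M : Fin q → Fin q → ℝ => (Matrix.of M).det :=
  Continuous.matrix_det (A := fun M : Fin q → Fin q → ℝ => Matrix.of M) continuous_id

theorem continuous_adjugate_of_apply (i j : Fin q) :
    Continuous fun M : Fin q → Fin q → ℝ => (Matrix.of M).adjugate i j :=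
  (Continuous.matrix_adjugate (A := fun M : Fin q → Fin q → ℝ => Matrix.of M)
    continuous_id).matrix_elem i j

theorem inv_of_apply (M : Fin q → Fin q → ℝ) (i j : Fin q) :
    (Matrix.of M)⁻¹ i j = (Matrix.of M).det⁻¹ * (Matrix.of M).adjugate i j := by
  rw [Matrix.inv_def, Ring.inverse_eq_inv', Matrix.smul_apply, smul_eq_mul]

theorem measurable_inv_of_apply (i j : Fin q) :
    Measurable fun M : Fin q → Fin q → ℝ => (Matrix.of M)⁻¹ i j := by
  simp only [inv_of_apply]
  exact continuous_det_of.measurable.inv.mul (continuous_adjugate_of_apply i j).measurable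

theorem invQuad_eq_sum (p : (Fin q → ℝ) × (Fin q → Fin q → ℝ)) :
    invQuad p = ∑ i, ∑ j, p.1 i * ((Matrix.of p.2)⁻¹ i j * p.1 j) := by
  simp only [invQuad, dotProduct, Matrix.mulVec, Finset.mul_sum]

theorem measurable_invQuad : Measurable (invQuad (q := q)) := by
  have : (invQuad (q := q)) =
      fun p => ∑ i, ∑ j, p.1 i * ((Matrix.of p.2)⁻¹ i j * p.1 j) := by
    ext p; exact invQuad_eq_sum p
  rw [this]
  refine Finset.measurable_sum _ fun i _ => Finset.measurable_sum _ fun j _ => ?_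
  have := (measurable_inv_of_apply i j).comp (measurable_snd :
    Measurable (Prod.snd : (Fin q → ℝ) × (Fin q → Fin q → ℝ) → Fin q → Fin q → ℝ))
  have h1 : Measurable fun p : (Fin q → ℝ) × (Fin q → Fin q → ℝ) => p.1 i := by fun_prop
  have h2 : Measurable fun p : (Fin q → ℝ) × (Fin q → Fin q → ℝ) => p.1 j := by fun_prop
  exact h1.mul (this.mul h2)

theorem continuousAt_invQuad {p : (Fin q → ℝ) × (Fin q → Fin q → ℝ)}
    (hp : (Matrix.of p.2).det ≠ 0) : ContinuousAt invQuad p := by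
  have : (invQuad (q := q)) = fun p => ∑ i, ∑ j, p.1 i *
      (((Matrix.of p.2).det⁻¹ * (Matrix.of p.2).adjugate i j) * p.1 j) := by
    ext p; rw [invQuad_eq_sum]; simp only [inv_of_apply]
  rw [this]
  refine tendsto_finsetSum _ fun i _ => tendsto_finsetSum _ fun j _ => ?_
  have h1 : ContinuousAt (fun p : (Fin q → ℝ) × (Fin q → Fin q → ℝ) => (Matrix.of p.2).det⁻¹) p :=
    (continuous_det_of.comp continuous_snd).continuousAt.inv₀ hp
  have h2 := ((continuous_adjugate_of_apply i j).comp
    (continuous_snd (X := Fin q → ℝ))).continuousAt (x := p)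
  have h3 : ContinuousAt (fun p : (Fin q → ℝ) × (Fin q → Fin q → ℝ) => p.1 i) p := by fun_prop
  have h4 : ContinuousAt (fun p : (Fin q → ℝ) × (Fin q → Fin q → ℝ) => p.1 j) p := by fun_prop
  exact h3.mul ((h1.mul h2).mul h4)

/-- Along a line in a direction `i` with `(M⁻¹)ᵢᵢ ≠ 0` the form `v' M⁻¹ v` is a nondegenerate
quadratic polynomial, so that it takes each value finitely often. -/
theorem finite_setOf_invQuad_update_eq {M : Fin q → Fin q → ℝ} {i : Fin q}
    (hM : (Matrix.of M)⁻¹ i i ≠ 0) (v : Fin q → ℝ) (c : ℝ) :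
    {x : ℝ | invQuad (Function.update v i x, M) = c}.Finite := by
  set A := (Matrix.of M)⁻¹ with hA
  set w := Function.update v i 0 with hw
  have hupd : ∀ x, Function.update v i x = w + x • Pi.single i (1 : ℝ) := by
    intro x
    ext j
    by_cases h : j = i
    · subst h; simp [hw]
    · simp [hw, h]
  have hexp : ∀ x, invQuad (Function.update v i x, M) = A i i * x ^ 2 +
      (w ⬝ᵥ A.mulVec (Pi.single i 1) + Pi.single i 1 ⬝ᵥ A.mulVec w) * x + w ⬝ᵥ A.mulVec w := by
    intro x
    rw [invQuad, hupd]
    simp only [Matrix.mulVec_add, Matrix.mulVec_smul, dotProduct_add, add_dotProduct,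
      smul_dotProduct, dotProduct_smul, smul_eq_mul, ← hA]
    simp only [single_dotProduct, Matrix.mulVec_single, one_mul, MulOpposite.op_one, one_smul,
      Matrix.col_apply]
    ring
  set p : Polynomial ℝ := Polynomial.C (A i i) * Polynomial.X ^ 2 +
    Polynomial.C (w ⬝ᵥ A.mulVec (Pi.single i 1) + Pi.single i 1 ⬝ᵥ A.mulVec w) * Polynomial.X +
    Polynomial.C (w ⬝ᵥ A.mulVec w - c) with hp
  have hp0 : p ≠ 0 := by
    intro h0
    have := congrArg (fun r => Polynomial.coeff r 2) h0
    simp [hp] at this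
    exact hM this
  refine p.roots.toFinset.finite_toSet.subset fun x (hx : _ = c) => ?_
  rw [hexp] at hx
  simp only [Finset.mem_coe, Multiset.mem_toFinset]
  refine (Polynomial.mem_roots hp0).2 ?_
  simp only [Polynomial.IsRoot, hp, Polynomial.eval_add, Polynomial.eval_mul, Polynomial.eval_C,
    Polynomial.eval_pow, Polynomial.eval_X]
  linarith

end InvQuad

/-! ### Polynomials in independent atomless random variables -/

/-- The zero set of a nonzero polynomial is null for a product of atomless laws: for almost every
value of the other variables, it is a nonzero polynomial in the first one. -/
theorem MvPolynomial.ae_pi_eval_ne_zero {n : ℕ} (μ : Fin n → Measure ℝ)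
    [∀ i, IsProbabilityMeasure (μ i)] [∀ i, NullSingletonClass (μ i)]
    {p : MvPolynomial (Fin n) ℝ} (hp : p ≠ 0) :
    ∀ᵐ x ∂Measure.pi μ, eval x p ≠ 0 := by
  induction n with
  | zero =>
    refine Eventually.of_forall fun x hx => hp ?_
    rw [p.eq_C_of_isEmpty] at hx ⊢
    simpa using hx
  | succ n ih =>
    set F := finSuccEquiv ℝ n p with hF
    have hF0 : F ≠ 0 := by simpa [hF] using hp
    have hlc := ih (fun i => μ i.succ) (Polynomial.leadingCoeff_ne_zero.2 hF0)
    have hms : MeasurableSet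
        {z : ℝ × (Fin n → ℝ) | eval (Fin.cons z.1 z.2 : Fin (n + 1) → ℝ) p = 0} := by
      refine (isClosed_eq ?_ continuous_const).measurableSet
      exact (MvPolynomial.continuous_eval p).comp (by fun_prop)
    have hprod : ∀ᵐ z ∂(μ 0).prod (Measure.pi fun i => μ (Fin.succ i)),
        eval (Fin.cons z.1 z.2 : Fin (n + 1) → ℝ) p ≠ 0 := by
      rw [ae_iff]
      simp only [not_not]
      rw [Measure.prod_apply_symm hms]
      refine (lintegral_congr_ae ?_).trans lintegral_zero
      filter_upwards [hlc] with x hx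
      have hmap : F.map (eval x) ≠ 0 := by
        intro h0
        apply hx
        have := congrArg (fun P => Polynomial.coeff P F.natDegree) h0
        simpa using this
      refine measure_mono_null ?_ ((F.map (eval x)).roots.toFinset.finite_toSet.measure_zero (μ 0))
      intro a ha
      have ha' : eval (Fin.cons a x : Fin (n + 1) → ℝ) p = 0 := ha
      rw [eval_eq_eval_mv_eval'] at ha'
      simp only [Finset.mem_coe, Multiset.mem_toFinset]
      exact (Polynomial.mem_roots hmap).2 ha'
    have hmp := measurePreserving_piFinSuccAbove μ 0
    have := hmp.quasiMeasurePreserving.ae hprod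
    filter_upwards [this] with x hx
    convert hx using 3
    exact (Fin.cons_self_tail x).symm

/-- A nonzero polynomial does not vanish at independent random variables with atomless laws. -/
theorem MvPolynomial.ae_eval_ne_zero_of_iIndepFun {Ω κ : Type*} [Fintype κ] [MeasurableSpace Ω]
    {P : Measure Ω} [IsProbabilityMeasure P] {ξ : κ → Ω → ℝ} (hξ : ∀ s, AEMeasurable (ξ s) P)
    (hind : iIndepFun ξ P) (hatom : ∀ s, NullSingletonClass (P.map (ξ s)))
    {p : MvPolynomial κ ℝ} (hp : p ≠ 0) :
    ∀ᵐ ω ∂P, eval (fun s => ξ s ω) p ≠ 0 := by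
  have e := (Fintype.equivFin κ).symm
  have h1 : iIndepFun (fun i => ξ (e i)) P := hind.precomp e.injective
  have h2 := h1.map_fun_eq_pi_map (fun i => hξ (e i))
  have : ∀ i, IsProbabilityMeasure (P.map (ξ (e i))) :=
    fun i => Measure.isProbabilityMeasure_map (hξ _)
  have h3 := MvPolynomial.ae_pi_eval_ne_zero (fun i => P.map (ξ (e i)))
    (p := rename e.symm p) (by simpa [rename_eq_zero_iff_of_injective _ e.symm.injective] using hp)
  rw [← h2] at h3
  filter_upwards [ae_of_ae_map (aemeasurable_pi_lambda _ fun i => hξ (e i)) h3] with ω hω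
  have hcomp : (fun i => ξ (e i) ω) ∘ e.symm = fun s => ξ s ω := by
    funext s
    simp
  rwa [eval_rename, hcomp] at hω

/-! ### Gaussian structure of a Brownian vector -/

section Brownian

variable {Ω' : Type*} [MeasurableSpace Ω'] {Q : Measure Ω'} {q : ℕ}
  {B : Fin q → ℝ≥0 → Ω' → ℝ}

theorem IsBrownianVector.isGaussianProcess [IsProbabilityMeasure Q] (hB : IsBrownianVector B Q) :
    IsGaussianProcess (fun (p : Fin q × ℝ≥0) ω => B p.1 p.2 ω) Q where
  hasGaussianLaw S := by
    classical
    set J : Finset ℝ≥0 := S.image Prod.snd with hJ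
    have h1 : ∀ i, HasGaussianLaw (fun ω => J.restrict (B i · ω)) Q :=
      fun i => IsGaussianProcess.hasGaussianLaw
        (IsPreBrownianReal.isGaussianProcess (hB.isBrownian i).toIsPreBrownianReal) J
    have h2 : iIndepFun (fun i ω => J.restrict (B i · ω)) Q :=
      hB.indep.comp (fun _ x => J.restrict x) fun _ => by fun_prop
    let L : (Fin q → J → ℝ) →L[ℝ] (S → ℝ) := ContinuousLinearMap.pi fun p : S =>
      (ContinuousLinearMap.proj (R := ℝ) (φ := fun _ : J => ℝ)
        ⟨p.1.2, Finset.mem_image_of_mem _ p.2⟩).comp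
        (ContinuousLinearMap.proj (R := ℝ) (φ := fun _ : Fin q => J → ℝ) p.1.1)
    exact (iIndepFun.hasGaussianLaw h1 h2).map L

theorem IsBrownianVector.aemeasurable (hB : IsBrownianVector B Q) (i : Fin q) (t : ℝ≥0) :
    AEMeasurable (B i t) Q :=
  (hB.isBrownian i).aemeasurable t

theorem IsBrownianVector.memLp_two (hB : IsBrownianVector B Q) (i : Fin q) (t : ℝ≥0) :
    MemLp (B i t) 2 Q :=
  ((hB.isBrownian i).hasLaw_eval t).hasGaussianLaw.memLp_two

theorem IsBrownianVector.covariance_eval [IsProbabilityMeasure Q] (hB : IsBrownianVector B Q)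
    (i j : Fin q) (s t : ℝ≥0) :
    cov[B i s, B j t; Q] = if i = j then (min s t : ℝ) else 0 := by
  split_ifs with h
  · subst h
    rw [(hB.isBrownian i).covariance_eval]
    push_cast
    rfl
  · have h1 : IndepFun (B i s) (B j t) Q :=
      (hB.indep.indepFun h).comp (φ := fun x : ℝ≥0 → ℝ => x s)
        (ψ := fun x : ℝ≥0 → ℝ => x t) (by fun_prop) (by fun_prop)
    exact h1.covariance_eq_zero (hB.memLp_two i s) (hB.memLp_two j t)

/-- Linear combinations of two values of a Gaussian process form a Gaussian process. -/
theorem ProbabilityTheory.IsGaussianProcess.add_mul {S T : Type*} {X : T → Ω' → ℝ}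
    (hX : IsGaussianProcess X Q) (a b : S → ℝ) (e f : S → T) :
    IsGaussianProcess (fun s ω => a s * X (e s) ω + b s * X (f s) ω) Q := by
  classical
  refine hX.of_isGaussianProcess fun s => ⟨{e s, f s},
    a s • ContinuousLinearMap.proj ⟨e s, by simp⟩ + b s • ContinuousLinearMap.proj ⟨f s, by simp⟩,
    fun ω => ?_⟩
  simp

theorem covariance_add_mul_add_mul [IsProbabilityMeasure Q] {X Y Z W : Ω' → ℝ} (hX : MemLp X 2 Q)
    (hY : MemLp Y 2 Q) (hZ : MemLp Z 2 Q) (hW : MemLp W 2 Q) (a b c d : ℝ) :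
    cov[fun ω => a * X ω + b * Y ω, fun ω => c * Z ω + d * W ω; Q] =
      a * c * cov[X, Z; Q] + a * d * cov[X, W; Q] + b * c * cov[Y, Z; Q] +
        b * d * cov[Y, W; Q] := by
  have h1 : (fun ω => a * X ω + b * Y ω) = (fun ω => a * X ω) + fun ω => b * Y ω := rfl
  have h2 : (fun ω => c * Z ω + d * W ω) = (fun ω => c * Z ω) + fun ω => d * W ω := rfl
  rw [h1, h2, covariance_add_left (hX.const_mul a) (hY.const_mul b)
      ((hZ.const_mul c).add (hW.const_mul d)),
    covariance_add_right (hX.const_mul a) (hZ.const_mul c) (hW.const_mul d),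
    covariance_add_right (hY.const_mul b) (hZ.const_mul c) (hW.const_mul d)]
  simp only [covariance_const_mul_left, covariance_const_mul_right]
  ring

/-- The increments of a Brownian vector over the intervals `[k / n, (k + 1) / n]` are independent
jointly in the coordinate and in `k`. -/
theorem IsBrownianVector.iIndepFun_increments [IsProbabilityMeasure Q] (hB : IsBrownianVector B Q)
    (n : ℕ) :
    iIndepFun (fun (p : Fin q × Fin n) ω =>
      B p.1 ((p.2 + 1 : ℝ≥0) / n) ω - B p.1 ((p.2 : ℝ≥0) / n) ω) Q := by
  have h := (hB.isGaussianProcess.add_mul (S := Σ _ : Fin q × Fin n, Unit) (fun _ => 1)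
    (fun _ => -1) (fun p => (p.1.1, (p.1.2 + 1 : ℝ≥0) / n)) (fun p => (p.1.1, (p.1.2 : ℝ≥0) / n)))
  have h2 := IsGaussianProcess.iIndepFun_of_covariance_eq_zero (T := Fin q × Fin n)
    (S := fun _ => Unit) (X := fun p _ ω => 1 * B p.1 ((p.2 + 1 : ℝ≥0) / n) ω
      + (-1) * B p.1 ((p.2 : ℝ≥0) / n) ω) h
    (fun p _ => ((hB.aemeasurable _ _).const_mul _).add ((hB.aemeasurable _ _).const_mul _)) ?_
  · convert h2.comp (fun _ x => x ()) (fun _ => by fun_prop) using 3 with p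
    simp [sub_eq_add_neg]
  · rintro ⟨i, k⟩ ⟨j, l⟩ hne - -
    dsimp only
    rw [covariance_add_mul_add_mul (hB.memLp_two _ _) (hB.memLp_two _ _) (hB.memLp_two _ _)
      (hB.memLp_two _ _)]
    simp only [hB.covariance_eval]
    by_cases hij : i = j
    · subst hij
      have hkl : (k : ℕ) ≠ l := fun h => hne (by rw [Fin.ext h])
      simp only [if_true]
      push_cast
      have hmono : ∀ a b : ℝ, min (a / n) (b / n) = min a b / n := fun a b =>
        (min_div_div_right (Nat.cast_nonneg n) a b)
      simp only [hmono]
      rcases lt_or_gt_of_ne hkl with h | h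
      · have h1 : ((k : ℕ) : ℝ) + 1 ≤ (l : ℕ) := by exact_mod_cast h
        rw [min_eq_left (by linarith), min_eq_left (by linarith), min_eq_left (by linarith),
          min_eq_left (by linarith)]
        ring
      · have h1 : ((l : ℕ) : ℝ) + 1 ≤ (k : ℕ) := by exact_mod_cast h
        rw [min_eq_right (by linarith), min_eq_right (by linarith), min_eq_right (by linarith),
          min_eq_right (by linarith)]
        ring
    · simp [hij]

theorem IsBrownianVector.nullSingletonClass_increment (hB : IsBrownianVector B Q)
    (i : Fin q) {s t : ℝ≥0} (hst : s ≠ t) :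
    NullSingletonClass (Q.map (fun ω => B i s ω - B i t ω)) := by
  have h := (hB.isBrownian i).hasLaw_sub s t
  have h1 : Q.map (fun ω => B i s ω - B i t ω) = _ := h.map_eq
  rw [h1]
  refine nullSingletonClass_gaussianReal ?_
  simpa [nndist_eq_zero] using hst

/-- The determinant of the centred increments is almost surely nonzero: it is a nonzero polynomial
in independent Gaussian variables. -/
theorem IsBrownianVector.ae_det_increments_ne_zero [IsProbabilityMeasure Q]
    (hB : IsBrownianVector B Q) :
    ∀ᵐ ω ∂Q, (Matrix.of fun i k : Fin q =>
      (B i (((k : ℕ) + 1 : ℝ≥0) / (q + 1 : ℕ)) ω - B i (((k : ℕ) : ℝ≥0) / (q + 1 : ℕ)) ω) -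
        (B i ((q + 1 : ℝ≥0) / (q + 1 : ℕ)) ω - B i ((q : ℝ≥0) / (q + 1 : ℕ)) ω)).det ≠ 0 := by
  set M : Matrix (Fin q) (Fin q) (MvPolynomial (Fin q × Fin (q + 1)) ℝ) :=
    Matrix.of fun i k => MvPolynomial.X (i, k.castSucc) - MvPolynomial.X (i, Fin.last q) with hM
  have heval : ∀ x : Fin q × Fin (q + 1) → ℝ, MvPolynomial.eval x M.det =
      (Matrix.of fun i k : Fin q => x (i, k.castSucc) - x (i, Fin.last q)).det := by
    intro x
    rw [RingHom.map_det]
    congr 1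
    ext i k
    simp [hM]
  have hdet : M.det ≠ 0 := by
    intro h0
    -- At this point of evaluation the matrix is the identity.
    have h1 := heval fun p => if p.2 = p.1.castSucc then 1 else 0
    rw [h0, map_zero] at h1
    have h2 : (Matrix.of fun i k : Fin q =>
        ((if k.castSucc = i.castSucc then 1 else 0) -
          (if Fin.last q = i.castSucc then 1 else 0) : ℝ)) = 1 := by
      ext i k
      simp [Matrix.one_apply, eq_comm]
    simp only at h1
    rw [h2] at h1
    simp at h1
  have h := MvPolynomial.ae_eval_ne_zero_of_iIndepFun
    (fun p => (hB.aemeasurable _ _).sub (hB.aemeasurable _ _))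
    (hB.iIndepFun_increments (q + 1)) (fun p => hB.nullSingletonClass_increment _ ?_) hdet
  · filter_upwards [h] with ω hω
    rw [heval] at hω
    simpa using hω
  · intro h0
    have hq : ((q + 1 : ℕ) : ℝ≥0) ≠ 0 := by positivity
    rw [div_left_inj' hq] at h0
    simp at h0

end Brownian

/-! ### The Gram matrix of the Brownian bridges -/

/-- The Gram matrix in `L²[0, 1]` of linearly independent continuous functions is positive
definite. -/
theorem posDef_gram_of_continuous {q : ℕ} {x : Fin q → ℝ → ℝ} (hx : ∀ i, Continuous (x i))
    (hind : ∀ a : Fin q → ℝ, (∀ r ∈ Icc (0 : ℝ) 1, ∑ i, a i * x i r = 0) → a = 0) :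
    (Matrix.of fun i j => ∫ r in (0 : ℝ)..1, x i r * x j r).PosDef := by
  have hquad : ∀ a : Fin q → ℝ,
      a ⬝ᵥ Matrix.mulVec (Matrix.of fun i j => ∫ r in (0 : ℝ)..1, x i r * x j r) a =
        ∫ r in (0 : ℝ)..1, (∑ i, a i * x i r) ^ 2 := by
    intro a
    have hii : ∀ i j, IntervalIntegrable (fun r => a i * (x i r * x j r * a j)) volume 0 1 :=
      fun i j => Continuous.intervalIntegrable (by fun_prop) _ _
    simp only [dotProduct, Matrix.mulVec, Matrix.of_apply, Finset.mul_sum]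
    simp_rw [← intervalIntegral.integral_mul_const, ← intervalIntegral.integral_const_mul]
    simp_rw [← intervalIntegral.integral_finsetSum (fun j _ => hii _ j)]
    rw [← intervalIntegral.integral_finsetSum
      (fun i _ => Continuous.intervalIntegrable (by fun_prop) _ _)]
    refine intervalIntegral.integral_congr fun r _ => ?_
    simp only [sq, Finset.sum_mul, Finset.mul_sum]
    exact Finset.sum_congr rfl fun i _ => Finset.sum_congr rfl fun j _ => by ring
  refine Matrix.PosDef.of_dotProduct_mulVec_pos ?_ fun a ha => ?_
  · ext i j
    simp [mul_comm]
  · rw [star_trivial, hquad]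
    refine intervalIntegral.integral_pos one_pos (by fun_prop) (fun r _ => sq_nonneg _) ?_
    by_contra! h
    refine ha (hind a fun r hr => ?_)
    have := h r hr
    exact pow_eq_zero_iff two_ne_zero |>.1 (le_antisymm this (sq_nonneg _))

section Brownian

variable {Ω' : Type*} [MeasurableSpace Ω'] {Q : Measure Ω'} {q : ℕ}
  {B : Fin q → ℝ≥0 → Ω' → ℝ}

theorem IsBrownianVector.ae_continuous (hB : IsBrownianVector B Q) :
    ∀ᵐ ω ∂Q, ∀ i, Continuous (B i · ω) :=
  ae_all_iff.2 fun i => (hB.isBrownian i).cont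

/-- Almost surely the bridges `B_i(r) - r B_i(1)` are linearly independent functions. If a
combination of them vanishes, all increments of that combination of the `B_i` over intervals of the
same length agree, which is a singularity of the matrix of centred increments. -/
theorem IsBrownianVector.ae_posDef_bridgeGram [IsProbabilityMeasure Q]
    (hB : IsBrownianVector B Q) : ∀ᵐ ω ∂Q, (bridgeGram B ω).PosDef := by
  filter_upwards [hB.ae_continuous, hB.ae_det_increments_ne_zero] with ω hc hdet
  refine posDef_gram_of_continuous (x := fun i r => brownianVec B r ω i - r * brownianVec B 1 ω i)
    (fun i => ?_) fun a ha => ?_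
  · have := hc i
    unfold brownianVec
    fun_prop
  · have h1 : ∀ s : ℝ≥0, s ≤ 1 → ∑ i, a i * B i s ω = s * ∑ i, a i * B i 1 ω := by
      intro s hs
      have := ha s ⟨s.2, by exact_mod_cast hs⟩
      simp only [brownianVec, Real.toNNReal_coe, Real.toNNReal_one, mul_sub,
        Finset.sum_sub_distrib, sub_eq_zero] at this
      rw [this, Finset.mul_sum]
      exact Finset.sum_congr rfl fun i _ => by ring
    have hq : (0 : ℝ≥0) < (q + 1 : ℕ) := by positivity
    have hinc : ∀ k : ℕ, k ≤ q → ∑ i, a i * (B i ((k + 1 : ℝ≥0) / (q + 1 : ℕ)) ω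
        - B i ((k : ℝ≥0) / (q + 1 : ℕ)) ω) = (∑ i, a i * B i 1 ω) / (q + 1 : ℕ) := by
      intro k hk
      have hk' : (k : ℝ≥0) + 1 ≤ (q + 1 : ℕ) := by exact_mod_cast Nat.succ_le_succ hk
      have e1 := h1 ((k + 1 : ℝ≥0) / (q + 1 : ℕ)) (div_le_one_of_le₀ hk' hq.le)
      have e2 := h1 ((k : ℝ≥0) / (q + 1 : ℕ))
        (div_le_one_of_le₀ (le_trans (by simp) hk') hq.le)
      simp only [mul_sub, Finset.sum_sub_distrib, e1, e2]
      push_cast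
      field_simp
      ring
    refine Matrix.eq_zero_of_vecMul_eq_zero hdet ?_
    ext k
    simp only [Matrix.vecMul, dotProduct, Matrix.of_apply, Pi.zero_apply]
    have e1 := hinc k k.2.le
    have e2 := hinc q le_rfl
    simp only [mul_sub _ (_ - _) (_ - _), Finset.sum_sub_distrib _ _, e1, e2, sub_self]

end Brownian

/-! ### The law of the pivot -/

section Pivot

variable {Ω' : Type*} [MeasurableSpace Ω'] {Q : Measure Ω'} {q : ℕ}
  {B : Fin q → ℝ≥0 → Ω' → ℝ}

/-- The time `t / N` of the pair `(N, t)`, capped at `1`. Without the cap the bridge at times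
beyond `1` would be correlated with the endpoint. -/
noncomputable def gridTime (p : ℕ × ℕ) : ℝ≥0 := min (p.2 / p.1) 1

theorem gridTime_le_one (p : ℕ × ℕ) : gridTime p ≤ 1 := min_le_right _ _

theorem coe_gridTime {N t : ℕ} (ht : t ∈ Finset.Icc 1 N) : (gridTime (N, t) : ℝ) = t / N := by
  have h : (t : ℝ≥0) / N ≤ 1 :=
    div_le_one_of_le₀ (by exact_mod_cast (Finset.mem_Icc.1 ht).2) zero_le
  rw [gridTime, min_eq_left h]
  push_cast
  rfl

/-- What remains of a Brownian vector on the time grid when the endpoint of coordinate `i₀` is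
removed: the bridges of all coordinates at all grid times, and the endpoints of the other
coordinates. -/
noncomputable def bridgeData (B : Fin q → ℝ≥0 → Ω' → ℝ) (i₀ : Fin q)
    (s : (Fin q × ℕ × ℕ) ⊕ Fin q) (ω : Ω') : ℝ :=
  match s with
  | .inl (i, p) => B i (gridTime p) ω - gridTime p * B i 1 ω
  | .inr j => if j = i₀ then 0 else B j 1 ω

theorem IsBrownianVector.aemeasurable_bridgeData (hB : IsBrownianVector B Q) (i₀ : Fin q)
    (s : (Fin q × ℕ × ℕ) ⊕ Fin q) : AEMeasurable (bridgeData B i₀ s) Q := by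
  rcases s with ⟨i, p⟩ | j
  · exact (hB.aemeasurable _ _).sub ((hB.aemeasurable _ _).const_mul _)
  · by_cases h : j = i₀
    · have : bridgeData B i₀ (.inr j) = fun _ => 0 := by ext; simp [bridgeData, h]
      exact this ▸ aemeasurable_const
    · have : bridgeData B i₀ (.inr j) = B j 1 := by ext; simp [bridgeData, h]
      exact this ▸ hB.aemeasurable j 1

/-- The endpoint of one coordinate is independent of the bridges and of the other endpoints: all
these variables are jointly Gaussian and uncorrelated. -/
theorem IsBrownianVector.indepFun_bridgeData [IsProbabilityMeasure Q] (hB : IsBrownianVector B Q)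
    (i₀ : Fin q) : IndepFun (fun ω s => bridgeData B i₀ s ω) (B i₀ 1) Q := by
  set a : (Fin q × ℕ × ℕ) ⊕ Fin q → ℝ := Sum.elim (fun _ => 1) (fun j => if j = i₀ then 0 else 1)
    with ha
  set b : (Fin q × ℕ × ℕ) ⊕ Fin q → ℝ := Sum.elim (fun p => -(gridTime p.2 : ℝ)) (fun _ => 0)
    with hb
  set e : (Fin q × ℕ × ℕ) ⊕ Fin q → Fin q × ℝ≥0 :=
    Sum.elim (fun p => (p.1, gridTime p.2)) (fun j => (j, 1)) with he
  set f : (Fin q × ℕ × ℕ) ⊕ Fin q → Fin q × ℝ≥0 :=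
    Sum.elim (fun p => (p.1, 1)) (fun j => (j, 1)) with hf
  have hrep : ∀ s, bridgeData B i₀ s =
      fun ω => a s * B (e s).1 (e s).2 ω + b s * B (f s).1 (f s).2 ω := by
    rintro (⟨i, p⟩ | j)
    · ext ω; simp [bridgeData, ha, hb, he, hf, sub_eq_add_neg]
    · ext ω; simp [bridgeData, ha, hb, he]
  have hgp := hB.isGaussianProcess.add_mul (S := ((Fin q × ℕ × ℕ) ⊕ Fin q) ⊕ Unit)
    (Sum.elim a fun _ => 1) (Sum.elim b fun _ => 0)
    (Sum.elim e fun _ => (i₀, 1)) (Sum.elim f fun _ => (i₀, 1))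
  have hind := IsGaussianProcess.indepFun_of_covariance_eq_zero
    (X := bridgeData B i₀) (Y := fun _ : Unit => B i₀ 1) (P := Q) ?_
    (hB.aemeasurable_bridgeData i₀) (fun _ => hB.aemeasurable _ _) ?_
  · exact hind.comp (φ := id) (ψ := fun x : Unit → ℝ => x ()) measurable_id (by fun_prop)
  · convert hgp using 1
    ext s ω
    rcases s with s | s
    · simp [hrep]
    · simp
  · intro s _
    have h1 : B i₀ 1 = fun ω => 1 * B i₀ 1 ω + 0 * B i₀ 1 ω := by ext; simp
    rw [hrep, h1, covariance_add_mul_add_mul (hB.memLp_two _ _) (hB.memLp_two _ _)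
      (hB.memLp_two _ _) (hB.memLp_two _ _)]
    simp only [hB.covariance_eval]
    rcases s with ⟨i, p⟩ | j
    · have : (gridTime p : ℝ) ≤ 1 := by exact_mod_cast gridTime_le_one p
      simp only [ha, hb, he, hf, Sum.elim_inl]
      split_ifs <;> simp [this]
    · simp only [ha, hb, he, hf, Sum.elim_inr]
      split_ifs <;> simp

/-- The Gram matrix of the bridges as a measurable function of their values on the grid. The upper
limit is a limit for continuous paths, and is measurable in any case. -/
noncomputable def gridGram (y : (Fin q × ℕ × ℕ) ⊕ Fin q → ℝ) : Fin q → Fin q → ℝ :=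
  fun i j => limsup (fun N : ℕ => (N : ℝ)⁻¹ *
    ∑ t ∈ Finset.Icc 1 N, y (.inl (i, N, t)) * y (.inl (j, N, t))) atTop

theorem measurable_gridGram : Measurable (gridGram (q := q)) := by
  refine measurable_pi_lambda _ fun i => measurable_pi_lambda _ fun j => Measurable.limsup ?_
  fun_prop

/-- The Gram matrix of the bridges is a limit of Riemann sums over the grid. -/
theorem tendsto_bridgeGram {Ω : Type*} {B : Fin q → ℝ≥0 → Ω → ℝ} {ω : Ω}
    (hc : ∀ i, Continuous (B i · ω)) (i j : Fin q) :
    Tendsto (fun N : ℕ => (N : ℝ)⁻¹ * ∑ t ∈ Finset.Icc 1 N,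
      (B i (gridTime (N, t)) ω - gridTime (N, t) * B i 1 ω) *
        (B j (gridTime (N, t)) ω - gridTime (N, t) * B j 1 ω)) atTop (𝓝 (bridgeGram B ω i j)) := by
  have hi := hc i
  have hj := hc j
  refine (tendsto_riemannSum (g := fun r => (brownianVec B r ω i - r * brownianVec B 1 ω i) *
    (brownianVec B r ω j - r * brownianVec B 1 ω j)) (by unfold brownianVec; fun_prop)).congr ?_
  intro N
  congr 1
  refine Finset.sum_congr rfl fun t ht => ?_
  simp only [brownianVec, ← coe_gridTime ht, Real.toNNReal_coe, Real.toNNReal_one]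

theorem IsBrownianVector.aemeasurable_bridgeGram (hB : IsBrownianVector B Q) (i j : Fin q) :
    AEMeasurable (fun ω => bridgeGram B ω i j) Q := by
  refine aemeasurable_of_tendsto_metrizable_ae atTop (f := fun (N : ℕ) ω => (N : ℝ)⁻¹ *
    ∑ t ∈ Finset.Icc 1 N, (B i (gridTime (N, t)) ω - gridTime (N, t) * B i 1 ω) *
        (B j (gridTime (N, t)) ω - gridTime (N, t) * B j 1 ω)) (fun N => ?_) ?_
  · refine AEMeasurable.const_mul (Finset.aemeasurable_fun_sum _ fun t _ => ?_) _
    exact ((hB.aemeasurable _ _).sub ((hB.aemeasurable _ _).const_mul _)).mul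
      ((hB.aemeasurable _ _).sub ((hB.aemeasurable _ _).const_mul _))
  · filter_upwards [hB.ae_continuous] with ω hω
    exact tendsto_bridgeGram hω i j

theorem pivot_eq_invQuad {Ω : Type*} {B : Fin q → ℝ≥0 → Ω → ℝ} (ω : Ω) :
    pivot B ω = invQuad (brownianVec B 1 ω, fun i j => bridgeGram B ω i j) := rfl

theorem IsBrownianVector.aemeasurable_pivot (hB : IsBrownianVector B Q) :
    AEMeasurable (pivot B) Q := by
  refine measurable_invQuad.comp_aemeasurable (f := fun ω =>
    (brownianVec B 1 ω, fun i j => bridgeGram B ω i j)) (AEMeasurable.prodMk ?_ ?_)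
  · exact aemeasurable_pi_lambda _ fun i => hB.aemeasurable i _
  · exact aemeasurable_pi_lambda _ fun i => aemeasurable_pi_lambda _ fun j =>
      hB.aemeasurable_bridgeGram i j

/-- The law of the pivot has no atoms. Given the bridges and all but one of the endpoints, the
pivot is a nondegenerate quadratic polynomial in the remaining endpoint, which is Gaussian and
independent of them. -/
theorem IsBrownianVector.nullSingletonClass_pivot [IsProbabilityMeasure Q] (hq : 0 < q)
    (hB : IsBrownianVector B Q) : NullSingletonClass (Q.map (pivot B)) := by
  refine ⟨fun c => ?_⟩
  rw [Measure.map_apply_of_aemeasurable hB.aemeasurable_pivot (measurableSet_singleton c)]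
  let i₀ : Fin q := ⟨0, hq⟩
  let v : ((Fin q × ℕ × ℕ) ⊕ Fin q → ℝ) → Fin q → ℝ := fun y j => y (.inr j)
  set S : Set (((Fin q × ℕ × ℕ) ⊕ Fin q → ℝ) × ℝ) :=
    {z | (Matrix.of (gridGram z.1))⁻¹ i₀ i₀ ≠ 0 ∧
      invQuad (Function.update (v z.1) i₀ z.2, gridGram z.1) = c} with hS
  have hSm : MeasurableSet S := by
    have hgg := measurable_gridGram.comp
      (measurable_fst : Measurable (Prod.fst : ((Fin q × ℕ × ℕ) ⊕ Fin q → ℝ) × ℝ → _))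
    have h1 := (measurable_inv_of_apply i₀ i₀).comp hgg
    have h2 : Measurable fun z : ((Fin q × ℕ × ℕ) ⊕ Fin q → ℝ) × ℝ =>
        Function.update (v z.1) i₀ z.2 := by
      refine measurable_pi_lambda _ fun j => ?_
      by_cases h : j = i₀
      · subst h; simpa using measurable_snd
      · simp only [Function.update_of_ne h, v]; fun_prop
    refine MeasurableSet.inter (h1 (measurableSet_singleton 0).compl) ?_
    exact (measurable_invQuad.comp (h2.prodMk hgg)) (measurableSet_singleton c)
  have hR : AEMeasurable (fun ω s => bridgeData B i₀ s ω) Q :=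
    aemeasurable_pi_lambda _ (hB.aemeasurable_bridgeData i₀)
  have hprod := (hB.indepFun_bridgeData i₀).map_prod_eq_prod_map_map hR (hB.aemeasurable i₀ 1)
  have hgauss : Q.map (B i₀ 1) = gaussianReal 0 1 := ((hB.isBrownian i₀).hasLaw_eval 1).map_eq
  have : NullSingletonClass (Q.map (B i₀ 1)) := by
    rw [hgauss]
    exact nullSingletonClass_gaussianReal one_ne_zero
  have hnull : Q ((fun ω => ((fun s => bridgeData B i₀ s ω), B i₀ 1 ω)) ⁻¹' S) = 0 := by
    rw [← Measure.map_apply_of_aemeasurable (hR.prodMk (hB.aemeasurable i₀ 1)) hSm, hprod,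
      Measure.measure_prod_null hSm]
    refine Eventually.of_forall fun y => ?_
    by_cases hy : (Matrix.of (gridGram y))⁻¹ i₀ i₀ = 0
    · simp [hS, hy]
    · refine measure_mono_null (fun x hx => hx.2)
        ((finite_setOf_invQuad_update_eq hy (v y) c).measure_zero _)
  refine measure_mono_null_ae ?_ hnull
  filter_upwards [hB.ae_continuous, hB.ae_posDef_bridgeGram] with ω hc hpd hω
  have hgram : gridGram (fun s => bridgeData B i₀ s ω) = fun i j => bridgeGram B ω i j := by
    ext i j
    exact (tendsto_bridgeGram hc i j).limsup_eq
  have hvec : Function.update (v fun s => bridgeData B i₀ s ω) i₀ (B i₀ 1 ω) =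
      brownianVec B 1 ω := by
    ext j
    by_cases h : j = i₀
    · subst h; simp [brownianVec]
    · simp [h, v, bridgeData, brownianVec]
  refine ⟨?_, ?_⟩
  · simp only [hgram]
    exact hpd.inv.diag_pos.ne'
  · simp only [hgram, hvec]
    exact hω

end Pivot

/-! ### Functionals on the Skorokhod space -/

theorem isCadlag_of_continuous {E : Type*} [TopologicalSpace E] {f : I → E} (hf : Continuous f) :
    IsCadlag f :=
  fun r => ⟨hf.continuousWithinAt, f r, hf.continuousWithinAt⟩

namespace SkorokhodSpace

/-- Near a continuous path, the Skorokhod topology controls the uniform distance: the time change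
is absorbed by the uniform continuity of the path. -/
theorem eventually_dist_lt {E : Type*} [PseudoMetricSpace E] {f : SkorokhodSpace E}
    (hf : Continuous f.toFun) {ε : ℝ} (hε : 0 < ε) :
    ∀ᶠ g in 𝓝 f, ∀ r, dist (g.toFun r) (f.toFun r) < ε := by
  obtain ⟨δ, hδ, hd⟩ := Metric.uniformContinuous_iff.1
    (CompactSpace.uniformContinuous_of_continuous hf) (ε / 2) (half_pos hε)
  set η := min δ (ε / 2) with hη
  have hηpos : 0 < η := lt_min hδ (half_pos hε)
  filter_upwards [Metric.eball_mem_nhds f (ENNReal.ofReal_pos.2 hηpos)] with g hg r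
  rw [Metric.mem_eball, edist_comm, edist_def, iInf_lt_iff] at hg
  obtain ⟨lam, hlam⟩ := hg
  obtain ⟨h1, h2⟩ := max_lt_iff.1 hlam
  have h3 := (le_iSup (fun t : I => edist (lam t) t) (lam.symm r)).trans_lt h1
  have h4 := (le_iSup (fun t : I => edist (f.toFun t) (g.toFun (lam t))) (lam.symm r)).trans_lt h2
  rw [OrderIso.apply_symm_apply, edist_lt_ofReal] at h3 h4
  have h5 := hd ((dist_comm (lam.symm r) r).trans_lt (h3.trans_le (min_le_left _ _)))
  calc dist (g.toFun r) (f.toFun r)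
      ≤ dist (g.toFun r) (f.toFun (lam.symm r)) + dist (f.toFun (lam.symm r)) (f.toFun r) :=
        dist_triangle _ _ _
    _ < ε / 2 + ε / 2 := add_lt_add ((dist_comm _ _).trans_lt (h4.trans_le (min_le_right _ _))) h5
    _ = ε := add_halves ε

variable {q : ℕ}

/-- The coordinate `i` of the bridge `f(r) - r f(1)`. Times outside `[0, 1]` are projected to
`[0, 1]`. -/
noncomputable def bridge (f : SkorokhodSpace (EuclideanSpace ℝ (Fin q))) (i : Fin q) (r : ℝ) : ℝ :=
  f.toFun (projIcc 0 1 zero_le_one r) i - (projIcc 0 1 zero_le_one r : I) * f.toFun 1 i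

/-- The endpoint of a path together with the Gram matrix of its bridge over the grid `t / N`. -/
noncomputable def gridEndGram (N : ℕ) (f : SkorokhodSpace (EuclideanSpace ℝ (Fin q))) :
    (Fin q → ℝ) × (Fin q → Fin q → ℝ) :=
  ((f.toFun 1).ofLp, fun i j => (N : ℝ)⁻¹ * ∑ t ∈ Finset.Icc 1 N,
    bridge f i (t / N) * bridge f j (t / N))

/-- The endpoint of a path together with the Gram matrix of its bridge in `L²[0, 1]`. -/
noncomputable def endGram (f : SkorokhodSpace (EuclideanSpace ℝ (Fin q))) :
    (Fin q → ℝ) × (Fin q → Fin q → ℝ) :=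
  ((f.toFun 1).ofLp, fun i j => ∫ r in (0 : ℝ)..1, bridge f i r * bridge f j r)

theorem continuous_bridge {f : SkorokhodSpace (EuclideanSpace ℝ (Fin q))}
    (hf : Continuous f.toFun) (i : Fin q) : Continuous (bridge f i) := by
  have h1 : Continuous fun r : ℝ => projIcc (0 : ℝ) 1 zero_le_one r := continuous_projIcc
  have h2 : Continuous fun r : ℝ => f.toFun (projIcc 0 1 zero_le_one r) := hf.comp h1
  unfold bridge
  fun_prop

theorem abs_bridge_sub_le {f g : SkorokhodSpace (EuclideanSpace ℝ (Fin q))} {δ : ℝ}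
    (h : ∀ r, dist (g.toFun r) (f.toFun r) < δ) (i : Fin q) (r : ℝ) :
    |bridge g i r - bridge f i r| ≤ 2 * δ := by
  have hcoord : ∀ s : I, |g.toFun s i - f.toFun s i| ≤ δ := fun s => by
    have := (PiLp.norm_apply_le (g.toFun s - f.toFun s) i).trans
      ((dist_eq_norm (g.toFun s) (f.toFun s)).symm.trans_le (h s).le)
    simpa [Real.norm_eq_abs] using this
  have h1 := hcoord (projIcc 0 1 zero_le_one r)
  have h2 := hcoord 1
  have h3 := (projIcc (0 : ℝ) 1 zero_le_one r).2
  set u : ℝ := ((projIcc (0 : ℝ) 1 zero_le_one r : I) : ℝ) with hu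
  have h4 : bridge g i r - bridge f i r =
      (g.toFun (projIcc 0 1 zero_le_one r) i - f.toFun (projIcc 0 1 zero_le_one r) i) -
        u * (g.toFun 1 i - f.toFun 1 i) := by
    simp only [bridge, ← hu]; ring
  rw [h4]
  refine (abs_sub _ _).trans ?_
  rw [abs_mul, abs_of_nonneg h3.1]
  have := mul_le_mul h3.2 h2 (abs_nonneg _) zero_le_one
  linarith

/-- The grid functionals converge continuously at continuous paths. -/
theorem tendsto_gridEndGram {f : SkorokhodSpace (EuclideanSpace ℝ (Fin q))}
    (hf : Continuous f.toFun) :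
    Tendsto (fun p : ℕ × SkorokhodSpace (EuclideanSpace ℝ (Fin q)) => gridEndGram p.1 p.2)
      (atTop ×ˢ 𝓝 f) (𝓝 (endGram f)) := by
  refine Tendsto.prodMk_nhds ?_ ?_
  · have h1 : Tendsto (fun g : SkorokhodSpace (EuclideanSpace ℝ (Fin q)) => g.toFun 1) (𝓝 f)
        (𝓝 (f.toFun 1)) := by
      rw [Metric.tendsto_nhds]
      intro ε hε
      filter_upwards [eventually_dist_lt hf hε] with g hg using hg 1
    have h2 : Continuous fun v : EuclideanSpace ℝ (Fin q) => v.ofLp := by fun_prop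
    exact (h2.tendsto _).comp (h1.comp tendsto_snd)
  refine tendsto_pi_nhds.2 fun i => tendsto_pi_nhds.2 fun j => ?_
  have hlim := (tendsto_riemannSum ((continuous_bridge hf i).mul (continuous_bridge hf j))).comp
    (tendsto_fst (f := atTop) (g := 𝓝 f))
  refine hlim.congr_dist ?_
  rw [Metric.tendsto_nhds]
  intro ε hε
  -- The bridges of `f` are bounded, as they are continuous and only depend on the projected time.
  obtain ⟨C, hC⟩ : ∃ C, ∀ k r, |bridge f k r| ≤ C := by
    have h1 : ∀ k, ∃ C, ∀ r, |bridge f k r| ≤ C := by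
      intro k
      obtain ⟨C, hC⟩ := isCompact_Icc.exists_bound_of_continuousOn
        ((continuous_bridge hf k).continuousOn (s := Icc (0 : ℝ) 1))
      refine ⟨C, fun r => ?_⟩
      have := hC (projIcc (0 : ℝ) 1 zero_le_one r) (Subtype.prop _)
      simpa [bridge, projIcc_val] using this
    choose C hC using h1
    exact ⟨∑ k, |C k|, fun k r => (hC k r).trans ((le_abs_self _).trans
      (Finset.single_le_sum (f := fun k => |C k|) (fun _ _ => abs_nonneg _) (Finset.mem_univ k)))⟩
  have hC0 : 0 ≤ C := (abs_nonneg _).trans (hC i 0)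
  set δ := min 1 (ε / (8 * (C + 1))) with hδ
  have hδ0 : 0 < δ := lt_min one_pos (by positivity)
  have hδC : δ * (8 * (C + 1)) ≤ ε := by
    have := min_le_right 1 (ε / (8 * (C + 1)))
    rwa [← hδ, le_div_iff₀ (by positivity)] at this
  have hev := (tendsto_snd (f := (atTop : Filter ℕ)) (g := 𝓝 f)).eventually
    (eventually_dist_lt hf hδ0)
  filter_upwards [hev] with ⟨N, g⟩ hg
  have hg' : ∀ k r, |bridge g k r - bridge f k r| ≤ 2 * δ := fun k r => abs_bridge_sub_le hg k r
  have hterm : ∀ r, |bridge f i r * bridge f j r - bridge g i r * bridge g j r| ≤ ε / 2 := by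
    intro r
    have h1 := hg' i r
    have h2 := hg' j r
    have h3 := hC i r
    have h4 := hC j r
    have hδ1 : δ ≤ 1 := min_le_left _ _
    have heq : bridge f i r * bridge f j r - bridge g i r * bridge g j r =
        -((bridge g i r - bridge f i r) * (bridge g j r - bridge f j r) +
          bridge f i r * (bridge g j r - bridge f j r) +
          (bridge g i r - bridge f i r) * bridge f j r) := by ring
    rw [heq, abs_neg]
    refine (abs_add_three _ _ _).trans ?_
    simp only [abs_mul]
    have e1 := mul_le_mul h1 h2 (abs_nonneg _) (by positivity)
    have e2 := mul_le_mul h3 h2 (abs_nonneg _) hC0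
    have e3 := mul_le_mul h1 h4 (abs_nonneg _) (by positivity)
    nlinarith
  rw [dist_zero_right, Real.norm_eq_abs, abs_of_nonneg dist_nonneg, Real.dist_eq]
  simp only [Function.comp_apply, Pi.mul_apply]
  rw [← mul_sub, ← Finset.sum_sub_distrib, abs_mul, abs_of_nonneg (by positivity)]
  calc (N : ℝ)⁻¹ * |∑ t ∈ Finset.Icc 1 N, (bridge f i (t / N) * bridge f j (t / N) -
        bridge g i (t / N) * bridge g j (t / N))|
      ≤ (N : ℝ)⁻¹ * ∑ t ∈ Finset.Icc 1 N, ε / 2 := by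
        gcongr
        exact (Finset.abs_sum_le_sum_abs _ _).trans (Finset.sum_le_sum fun t _ => hterm _)
    _ = (N : ℝ)⁻¹ * N * (ε / 2) := by simp; ring
    _ ≤ 1 * (ε / 2) := by
        gcongr
        exact inv_mul_le_one
    _ < ε := by linarith

end SkorokhodSpace

/-! ### The limit path -/

section LimitPath

variable {Ω' : Type*} {q : ℕ} {B : Fin q → ℝ≥0 → Ω' → ℝ} {ω : Ω'}

theorem limitPath_toFun (Δ : Matrix (Fin q) (Fin q) ℝ) (hc : ∀ i, Continuous (B i · ω)) :
    ((limitPath Δ B ω).toFun = fun r : I => WithLp.toLp 2 (Δ.mulVec (brownianVec B r ω))) ∧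
      Continuous (limitPath Δ B ω).toFun := by
  have h1 : Continuous fun r : I => WithLp.toLp 2 (Δ.mulVec (brownianVec B r ω)) := by
    have h2 : Continuous fun r : I => brownianVec B r ω := by
      refine continuous_pi fun i => ?_
      have := hc i
      unfold brownianVec
      fun_prop
    have h3 : Continuous fun r : I => Δ.mulVec (brownianVec B r ω) :=
      continuous_const.matrix_mulVec h2
    fun_prop
  have h2 : (limitPath Δ B ω).toFun =
      fun r : I => WithLp.toLp 2 (Δ.mulVec (brownianVec B r ω)) := by
    rw [limitPath, SkorokhodSpace.ofFun, dif_pos (isCadlag_of_continuous h1)]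
  exact ⟨h2, h2 ▸ h1⟩

/-- The endpoint and the Gram matrix of the limit path are `Δ B(1)` and `Δ V Δ'`. -/
theorem endGram_limitPath (Δ : Matrix (Fin q) (Fin q) ℝ) (hc : ∀ i, Continuous (B i · ω)) :
    SkorokhodSpace.endGram (limitPath Δ B ω) =
      (Δ.mulVec (brownianVec B 1 ω), fun i j => (Δ * bridgeGram B ω * Δ.transpose) i j) := by
  obtain ⟨hfun, -⟩ := limitPath_toFun Δ hc
  refine Prod.ext ?_ ?_
  · simp [SkorokhodSpace.endGram, hfun]
  · ext i j
    set x : Fin q → ℝ → ℝ := fun i r => brownianVec B r ω i - r * brownianVec B 1 ω i with hx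
    have hxc : ∀ k, Continuous (x k) := fun k => by
      have := hc k
      simp only [hx, brownianVec]
      fun_prop
    have hbr : ∀ k, ∀ r ∈ Icc (0 : ℝ) 1, SkorokhodSpace.bridge (limitPath Δ B ω) k r =
        ∑ l, Δ k l * x l r := by
      intro k r hr
      simp only [SkorokhodSpace.bridge, hfun, projIcc_of_mem zero_le_one hr, Matrix.mulVec,
        dotProduct, hx, mul_sub, Finset.sum_sub_distrib, Finset.mul_sum, Icc.coe_one]
      congr 1
      exact Finset.sum_congr rfl fun l _ => by ring
    have h1 : ∫ r in (0 : ℝ)..1, SkorokhodSpace.bridge (limitPath Δ B ω) i r *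
        SkorokhodSpace.bridge (limitPath Δ B ω) j r =
        ∫ r in (0 : ℝ)..1, ∑ l, ∑ k, Δ i k * (x k r * x l r) * Δ j l := by
      refine intervalIntegral.integral_congr fun r hr => ?_
      rw [uIcc_of_le zero_le_one] at hr
      simp only [hbr _ r hr, Finset.mul_sum, Finset.sum_mul]
      exact Finset.sum_congr rfl fun l _ => Finset.sum_congr rfl fun k _ => by ring
    simp only [SkorokhodSpace.endGram, h1, Matrix.mul_apply, Matrix.transpose_apply,
      Finset.sum_mul]
    rw [intervalIntegral.integral_finsetSum
      (fun l _ => Continuous.intervalIntegrable (by fun_prop) _ _)]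
    refine Finset.sum_congr rfl fun l _ => ?_
    rw [intervalIntegral.integral_finsetSum
      (fun k _ => Continuous.intervalIntegrable (by fun_prop) _ _)]
    refine Finset.sum_congr rfl fun k _ => ?_
    rw [intervalIntegral.integral_mul_const, intervalIntegral.integral_const_mul]
    rfl

/-- Self-normalization removes the unknown matrix `Δ`. -/
theorem invQuad_mulVec_conj {Δ V : Matrix (Fin q) (Fin q) ℝ} (hΔ : IsUnit Δ.det) (v : Fin q → ℝ) :
    invQuad (Δ.mulVec v, fun i j => (Δ * V * Δ.transpose) i j) = invQuad (v, fun i j => V i j) := by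
  have h1 : (Matrix.of fun i j => (Δ * V * Δ.transpose) i j) = Δ * V * Δ.transpose := rfl
  have h2 : (Matrix.of fun i j => V i j) = V := rfl
  have hΔt : IsUnit Δ.transpose.det := by rwa [Matrix.det_transpose]
  simp only [invQuad, h1, h2, Matrix.mul_inv_rev, Matrix.mulVec_mulVec]
  rw [Matrix.mul_assoc, Matrix.mul_assoc, Matrix.nonsing_inv_mul _ hΔ, Matrix.mul_one,
    Matrix.dotProduct_mulVec, Matrix.vecMul_mulVec, ← Matrix.dotProduct_mulVec]
  rw [← Matrix.mul_assoc, Matrix.mul_nonsing_inv _ hΔt, Matrix.one_mul]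

end LimitPath

/-! ### The remainder of the linear expansion -/

/-- A perturbation bound for Gram matrices, from the Cauchy-Schwarz inequality. -/
theorem abs_gram_add_sub_gram_le {q : ℕ} {κ : Type*} (s : Finset κ) {c : ℝ} (hc : 0 ≤ c)
    (z e : κ → EuclideanSpace ℝ (Fin q)) (i j : Fin q) :
    |c * ∑ t ∈ s, (z t + e t) i * (z t + e t) j - c * ∑ t ∈ s, z t i * z t j| ≤
      2 * (√(c * ∑ t ∈ s, ‖z t‖ ^ 2) * √(c * ∑ t ∈ s, ‖e t‖ ^ 2)) + c * ∑ t ∈ s, ‖e t‖ ^ 2 := by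
  have hcoord : ∀ (v : EuclideanSpace ℝ (Fin q)) k, |v k| ≤ ‖v‖ := fun v k => by
    simpa [Real.norm_eq_abs] using PiLp.norm_apply_le v k
  have hterm : ∀ t, |(z t + e t) i * (z t + e t) j - z t i * z t j| ≤
      2 * (‖z t‖ * ‖e t‖) + ‖e t‖ ^ 2 := by
    intro t
    have heq : (z t + e t) i * (z t + e t) j - z t i * z t j =
        z t i * e t j + e t i * z t j + e t i * e t j := by
      simp only [PiLp.add_apply]; ring
    rw [heq]
    refine (abs_add_three _ _ _).trans ?_
    simp only [abs_mul]
    have e1 := mul_le_mul (hcoord (z t) i) (hcoord (e t) j) (abs_nonneg _) (norm_nonneg _)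
    have e2 := mul_le_mul (hcoord (e t) i) (hcoord (z t) j) (abs_nonneg _) (norm_nonneg _)
    have e3 := mul_le_mul (hcoord (e t) i) (hcoord (e t) j) (abs_nonneg _) (norm_nonneg _)
    nlinarith
  have hcs := Real.sum_mul_le_sqrt_mul_sqrt s (fun t => ‖z t‖) (fun t => ‖e t‖)
  have hsqrt : √(c * ∑ t ∈ s, ‖z t‖ ^ 2) * √(c * ∑ t ∈ s, ‖e t‖ ^ 2) =
      c * (√(∑ t ∈ s, ‖z t‖ ^ 2) * √(∑ t ∈ s, ‖e t‖ ^ 2)) := by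
    rw [Real.sqrt_mul hc, Real.sqrt_mul hc]
    have := Real.mul_self_sqrt hc
    linear_combination (√(∑ t ∈ s, ‖z t‖ ^ 2) * √(∑ t ∈ s, ‖e t‖ ^ 2)) * this
  rw [hsqrt, ← mul_sub, ← Finset.sum_sub_distrib, abs_mul, abs_of_nonneg hc]
  calc c * |∑ t ∈ s, ((z t + e t) i * (z t + e t) j - z t i * z t j)|
      ≤ c * ∑ t ∈ s, (2 * (‖z t‖ * ‖e t‖) + ‖e t‖ ^ 2) := by
        gcongr
        exact (Finset.abs_sum_le_sum_abs _ _).trans (Finset.sum_le_sum fun t _ => hterm t)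
    _ = c * (2 * ∑ t ∈ s, ‖z t‖ * ‖e t‖) + c * ∑ t ∈ s, ‖e t‖ ^ 2 := by
        rw [Finset.sum_add_distrib, ← Finset.mul_sum]; ring
    _ ≤ _ := by
        have := mul_le_mul_of_nonneg_left hcs hc
        linarith

/-- The mean square of the scaled perturbations `t (R_t - R_N)`, split into the contributions of
`R_t` and of `R_N`. -/
theorem mean_norm_sq_sub_le {E : Type*} [SeminormedAddCommGroup E] [NormedSpace ℝ E] (R : ℕ → E)
    {N : ℕ} (hN : 0 < N) :
    (N : ℝ)⁻¹ * ∑ t ∈ Finset.Icc 1 N, ‖(√(N : ℝ))⁻¹ • ((t : ℝ) • R t - (t : ℝ) • R N)‖ ^ 2 ≤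
      2 * (((N : ℝ) ^ 2)⁻¹ * ∑ t ∈ Finset.Icc 1 N, ‖(t : ℝ) • R t‖ ^ 2) +
        2 * ‖√(N : ℝ) • R N‖ ^ 2 := by
  have hN' : (0 : ℝ) < N := by exact_mod_cast hN
  have hsq : √(N : ℝ) ^ 2 = N := Real.sq_sqrt hN'.le
  have hu2 : ‖√(N : ℝ) • R N‖ ^ 2 = N * ‖R N‖ ^ 2 := by
    rw [norm_smul, mul_pow, Real.norm_eq_abs, sq_abs, hsq]
  have hterm : ∀ t ∈ Finset.Icc 1 N, ‖(√(N : ℝ))⁻¹ • ((t : ℝ) • R t - (t : ℝ) • R N)‖ ^ 2 ≤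
      2 * (N : ℝ)⁻¹ * ‖(t : ℝ) • R t‖ ^ 2 + 2 * (N * ‖R N‖ ^ 2) := by
    intro t ht
    have htN : (t : ℝ) ≤ N := by exact_mod_cast (Finset.mem_Icc.1 ht).2
    have h1 : ‖(√(N : ℝ))⁻¹ • ((t : ℝ) • R t - (t : ℝ) • R N)‖ ^ 2 =
        (N : ℝ)⁻¹ * ‖(t : ℝ) • R t - (t : ℝ) • R N‖ ^ 2 := by
      rw [norm_smul, mul_pow, norm_inv, Real.norm_eq_abs, inv_pow, sq_abs, hsq]
    have h2 : ‖(t : ℝ) • R t - (t : ℝ) • R N‖ ^ 2 ≤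
        2 * ‖(t : ℝ) • R t‖ ^ 2 + 2 * (N ^ 2 * ‖R N‖ ^ 2) := by
      have h3 : ‖(t : ℝ) • R N‖ ≤ N * ‖R N‖ := by
        rw [norm_smul, Real.norm_eq_abs, abs_of_nonneg (Nat.cast_nonneg t)]
        gcongr
      have h4 := norm_sub_le ((t : ℝ) • R t) ((t : ℝ) • R N)
      have h5 : ‖(t : ℝ) • R t - (t : ℝ) • R N‖ ^ 2 ≤ (‖(t : ℝ) • R t‖ + N * ‖R N‖) ^ 2 :=
        pow_le_pow_left₀ (norm_nonneg _) (h4.trans (by linarith)) 2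
      nlinarith [sq_nonneg (‖(t : ℝ) • R t‖ - N * ‖R N‖)]
    rw [h1]
    refine (mul_le_mul_of_nonneg_left h2 (inv_nonneg.2 hN'.le)).trans (le_of_eq ?_)
    generalize ‖(t : ℝ) • R t‖ = x
    generalize ‖R N‖ = y
    field_simp
  refine (mul_le_mul_of_nonneg_left (Finset.sum_le_sum hterm) (inv_nonneg.2 hN'.le)).trans
    (le_of_eq ?_)
  rw [Finset.sum_add_distrib, ← Finset.mul_sum, hu2]
  simp only [Finset.sum_const, Nat.card_Icc, Nat.add_sub_cancel, nsmul_eq_mul]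
  generalize ∑ t ∈ Finset.Icc 1 N, ‖(t : ℝ) • R t‖ ^ 2 = x
  generalize ‖R N‖ = y
  field_simp

section Statistic

variable {Ω : Type*} {m q : ℕ} (T : Measure (Fin m → ℝ) → EuclideanSpace ℝ (Fin q))
  (F : Measure (Fin m → ℝ)) (psi : (Fin m → ℝ) → EuclideanSpace ℝ (Fin q)) (X : ℤ → Ω → ℝ)

/-- The scaled estimation error `√N (θ̂_N - T(F))` together with the self-normalizer `W_N`. -/
noncomputable def errorPair (N : ℕ) (ω : Ω) : (Fin q → ℝ) × (Fin q → Fin q → ℝ) :=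
  ((√(N : ℝ) • (estimator T X N ω - T F)).ofLp, fun i j => selfNormalizer T X N ω i j)

/-- The mean square `N⁻² ∑_{t=1}^N |t R_t|²` of the remainders. -/
noncomputable def remainderMeanSq (N : ℕ) (ω : Ω) : ℝ :=
  ((N : ℝ) ^ 2)⁻¹ * ∑ t ∈ Finset.Icc 1 N, ‖(t : ℝ) • remainder T F psi X t ω‖ ^ 2

theorem remainderMeanSq_nonneg (N : ℕ) (ω : Ω) : 0 ≤ remainderMeanSq T F psi X N ω :=
  mul_nonneg (inv_nonneg.2 (sq_nonneg _)) (Finset.sum_nonneg fun _ _ => sq_nonneg _)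

/-- The bound for the distance of `errorPair` from its linearization with Gram matrix `x.1.2`, in
terms of the sizes `x.2` of the remainders. -/
noncomputable def linearizationBound
    (x : ((Fin q → ℝ) × (Fin q → Fin q → ℝ)) × (ℝ × ℝ)) : ℝ :=
  x.2.1 + (2 * (√(∑ i, x.1.2 i i) * √(2 * x.2.2 + 2 * x.2.1 ^ 2)) + (2 * x.2.2 + 2 * x.2.1 ^ 2))

theorem snStatistic_eq_invQuad (N : ℕ) (ω : Ω) :
    snStatistic T X (T F) N ω = invQuad (errorPair T F X N ω) := by
  have h1 : (Matrix.of fun i j => selfNormalizer T X N ω i j) = selfNormalizer T X N ω := rfl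
  simp only [snStatistic, invQuad, errorPair, h1, WithLp.ofLp_smul, Matrix.mulVec_smul,
    smul_dotProduct, dotProduct_smul, smul_eq_mul, ← mul_assoc,
    Real.mul_self_sqrt (Nat.cast_nonneg N)]

/-- The scaled error and the self-normalizer are, up to the remainders, the endpoint and the Gram
matrix of the partial sum path. -/
theorem norm_errorPair_sub_le {N : ℕ} (hN : 0 < N) (ω : Ω) :
    ‖errorPair T F X N ω - SkorokhodSpace.gridEndGram N (partialSumPath psi X N ω)‖ ≤
      linearizationBound (SkorokhodSpace.gridEndGram N (partialSumPath psi X N ω),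
        (‖√(N : ℝ) • remainder T F psi X N ω‖, remainderMeanSq T F psi X N ω)) := by
  set f := partialSumPath psi X N ω with hf
  set R : ℕ → EuclideanSpace ℝ (Fin q) := fun t => remainder T F psi X t ω with hR
  set S : ℕ → EuclideanSpace ℝ (Fin q) := fun t =>
    ∑ k ∈ Finset.Icc 1 t, psi (lagVector X m (k : ℤ) ω) with hS
  have hN' : (0 : ℝ) < N := by exact_mod_cast hN
  have hsq : √(N : ℝ) ^ 2 = N := Real.sq_sqrt hN'.le
  have hs0 : 0 < √(N : ℝ) := Real.sqrt_pos.2 hN'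
  have hest : ∀ t, estimator T X t ω - T F = (t : ℝ)⁻¹ • S t + R t := by
    intro t
    simp only [hR, hS, remainder]
    abel
  have hend : f.toFun 1 = (√(N : ℝ))⁻¹ • S N := by simp [hf, partialSumPath, hS]
  set z : ℕ → EuclideanSpace ℝ (Fin q) := fun t =>
    (√(N : ℝ))⁻¹ • S t - ((t : ℝ) / N) • ((√(N : ℝ))⁻¹ • S N) with hz
  set e : ℕ → EuclideanSpace ℝ (Fin q) := fun t =>
    (√(N : ℝ))⁻¹ • ((t : ℝ) • R t - (t : ℝ) • R N) with he
  have hbr : ∀ t ∈ Finset.Icc 1 N, ∀ i, SkorokhodSpace.bridge f i (t / N) = z t i := by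
    intro t ht i
    have htN : (t : ℝ) / N ∈ Icc (0 : ℝ) 1 :=
      ⟨by positivity, div_le_one_of_le₀ (by exact_mod_cast (Finset.mem_Icc.1 ht).2) hN'.le⟩
    have hfl : ⌊(t : ℝ) / N * N⌋₊ = t := by
      rw [div_mul_cancel₀ _ hN'.ne', Nat.floor_natCast]
    simp only [SkorokhodSpace.bridge, projIcc_of_mem zero_le_one htN, hend, hz, PiLp.sub_apply,
      PiLp.smul_apply, smul_eq_mul]
    simp only [hf, partialSumPath, hfl, hS, PiLp.smul_apply, smul_eq_mul]
  have hze : ∀ t ∈ Finset.Icc 1 N, z t + e t =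
      ((√(N : ℝ))⁻¹ * t) • (estimator T X t ω - estimator T X N ω) := by
    intro t ht
    have ht0 : (t : ℝ) ≠ 0 := by
      have := (Finset.mem_Icc.1 ht).1
      positivity
    have h1 : estimator T X t ω - estimator T X N ω =
        ((t : ℝ)⁻¹ • S t + R t) - ((N : ℝ)⁻¹ • S N + R N) := by
      rw [← hest, ← hest]; abel
    rw [h1]
    ext i
    simp only [hz, he, PiLp.add_apply, PiLp.sub_apply, PiLp.smul_apply, smul_eq_mul]
    field_simp
    ring
  have hW : ∀ i j, selfNormalizer T X N ω i j =
      (N : ℝ)⁻¹ * ∑ t ∈ Finset.Icc 1 N, (z t + e t) i * (z t + e t) j := by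
    intro i j
    simp only [selfNormalizer, Matrix.smul_apply, Matrix.sum_apply, Matrix.vecMulVec_apply,
      smul_eq_mul, Finset.mul_sum]
    refine Finset.sum_congr rfl fun t ht => ?_
    rw [hze t ht]
    simp only [PiLp.smul_apply, smul_eq_mul]
    have : ((√(N : ℝ))⁻¹) ^ 2 = (N : ℝ)⁻¹ := by rw [inv_pow, hsq]
    linear_combination (-(N : ℝ)⁻¹ * (t : ℝ) ^ 2 * (estimator T X t ω - estimator T X N ω) i *
      (estimator T X t ω - estimator T X N ω) j) * this
  have hG : ∀ i j, (SkorokhodSpace.gridEndGram N f).2 i j =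
      (N : ℝ)⁻¹ * ∑ t ∈ Finset.Icc 1 N, z t i * z t j := by
    intro i j
    simp only [SkorokhodSpace.gridEndGram]
    congr 1
    exact Finset.sum_congr rfl fun t ht => by rw [hbr t ht, hbr t ht]
  have htr : ∑ i, (SkorokhodSpace.gridEndGram N f).2 i i =
      (N : ℝ)⁻¹ * ∑ t ∈ Finset.Icc 1 N, ‖z t‖ ^ 2 := by
    simp only [hG, ← Finset.mul_sum]
    rw [Finset.sum_comm]
    congr 1
    refine Finset.sum_congr rfl fun t _ => ?_
    rw [EuclideanSpace.norm_sq_eq]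
    exact Finset.sum_congr rfl fun i _ => by rw [Real.norm_eq_abs, sq_abs, sq]
  set a := remainderMeanSq T F psi X N ω with ha
  set u := ‖√(N : ℝ) • remainder T F psi X N ω‖ with hu
  have hea : (N : ℝ)⁻¹ * ∑ t ∈ Finset.Icc 1 N, ‖e t‖ ^ 2 ≤ 2 * a + 2 * u ^ 2 :=
    mean_norm_sq_sub_le R hN
  have hu0 : 0 ≤ u := norm_nonneg _
  have ha0 : 0 ≤ a := remainderMeanSq_nonneg T F psi X N ω
  clear_value a u
  have hmat : ∀ i j, |selfNormalizer T X N ω i j - (SkorokhodSpace.gridEndGram N f).2 i j| ≤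
      2 * (√(∑ i, (SkorokhodSpace.gridEndGram N f).2 i i) * √(2 * a + 2 * u ^ 2)) +
        (2 * a + 2 * u ^ 2) := by
    intro i j
    rw [hW, hG, htr]
    have h1 := abs_gram_add_sub_gram_le (Finset.Icc 1 N) (inv_nonneg.2 hN'.le) z e i j
    have h2 := mul_le_mul_of_nonneg_left (Real.sqrt_le_sqrt hea)
      (Real.sqrt_nonneg ((N : ℝ)⁻¹ * ∑ t ∈ Finset.Icc 1 N, ‖z t‖ ^ 2))
    linarith
  rw [Prod.norm_def]
  simp only [linearizationBound]
  refine max_le ?_ ?_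
  · have h1 : (errorPair T F X N ω - SkorokhodSpace.gridEndGram N f).1 =
        (√(N : ℝ) • remainder T F psi X N ω).ofLp := by
      have h2 : √(N : ℝ) • (estimator T X N ω - T F) - f.toFun 1 = √(N : ℝ) • R N := by
        rw [hest, hend]
        ext i
        simp only [PiLp.add_apply, PiLp.sub_apply, PiLp.smul_apply, smul_eq_mul]
        field_simp
        rw [hsq]
        ring
      exact congrArg WithLp.ofLp h2
    have h3 : ‖(√(N : ℝ) • remainder T F psi X N ω).ofLp‖ ≤ u :=
      (pi_norm_le_iff_of_nonneg hu0).2 fun i =>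
        (PiLp.norm_apply_le _ i).trans_eq hu.symm
    rw [h1]
    have : 0 ≤ 2 * (√(∑ i, (SkorokhodSpace.gridEndGram N f).2 i i) * √(2 * a + 2 * u ^ 2)) +
        (2 * a + 2 * u ^ 2) := by positivity
    linarith
  · refine (pi_norm_le_iff_of_nonneg (by positivity)).2 fun i =>
      (pi_norm_le_iff_of_nonneg (by positivity)).2 fun j => ?_
    rw [Real.norm_eq_abs]
    exact (hmat i j).trans (by linarith)

theorem continuous_linearizationBound : Continuous (linearizationBound (q := q)) := by
  unfold linearizationBound
  fun_prop

end Statistic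

/-! ### Convergence of the scaled error and the self-normalizer -/

section Convergence

variable {Ω Ω' : Type*} [MeasurableSpace Ω] [MeasurableSpace Ω'] {P : Measure Ω} {Q : Measure Ω'}
  {m q : ℕ} {X : ℤ → Ω → ℝ}
  {T : Measure (Fin m → ℝ) → EuclideanSpace ℝ (Fin q)} {F : Measure (Fin m → ℝ)}
  {psi : (Fin m → ℝ) → EuclideanSpace ℝ (Fin q)}

theorem aemeasurable_sum_lagVector
    (hint : ∀ t : ℤ, AEMeasurable (fun ω => psi (lagVector X m t ω)) P) (s : Finset ℕ) :
    AEMeasurable (fun ω => ∑ t ∈ s, psi (lagVector X m (t : ℤ) ω)) P :=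
  Finset.aemeasurable_fun_sum _ fun t _ => hint t

theorem aemeasurable_gridEndGram_partialSumPath
    (hint : ∀ t : ℤ, AEMeasurable (fun ω => psi (lagVector X m t ω)) P) (N : ℕ) :
    AEMeasurable (fun ω => SkorokhodSpace.gridEndGram N (partialSumPath psi X N ω)) P := by
  have h1 : ∀ r, AEMeasurable (fun ω => (partialSumPath psi X N ω).toFun r) P := fun r =>
    (aemeasurable_sum_lagVector hint _).fun_const_smul _
  have h2 : ∀ r i, AEMeasurable (fun ω => (partialSumPath psi X N ω).toFun r i) P := fun r i =>
    (by fun_prop : Measurable fun v : EuclideanSpace ℝ (Fin q) => v i).comp_aemeasurable (h1 r)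
  have h3 : ∀ i r, AEMeasurable
      (fun ω => SkorokhodSpace.bridge (partialSumPath psi X N ω) i r) P := fun i r =>
    (h2 _ i).sub ((h2 1 i).const_mul _)
  refine (aemeasurable_pi_lambda _ fun i => h2 1 i).prodMk
    (aemeasurable_pi_lambda _ fun i => aemeasurable_pi_lambda _ fun j => ?_)
  exact (Finset.aemeasurable_fun_sum _ fun t _ => (h3 i _).mul (h3 j _)).const_mul _

theorem aemeasurable_errorPair (hT : ∀ N, AEMeasurable (estimator T X N) P) (N : ℕ) :
    AEMeasurable (errorPair T F X N) P := by
  have hco : ∀ i, Measurable fun v : EuclideanSpace ℝ (Fin q) => v i := fun i => by fun_prop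
  refine AEMeasurable.prodMk (aemeasurable_pi_lambda _ fun i => ?_)
    (aemeasurable_pi_lambda _ fun i => aemeasurable_pi_lambda _ fun j => ?_)
  · exact (hco i).comp_aemeasurable (((hT N).sub_const _).fun_const_smul _)
  · have h1 : ∀ t k, AEMeasurable (fun ω => (estimator T X t ω - estimator T X N ω) k) P :=
      fun t k => (hco k).comp_aemeasurable ((hT t).sub (hT N))
    simp only [selfNormalizer, Matrix.smul_apply, Matrix.sum_apply, Matrix.vecMulVec_apply,
      smul_eq_mul]
    exact (Finset.aemeasurable_fun_sum _ fun t _ =>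
      ((h1 t i).mul (h1 t j)).const_mul _).const_mul _

theorem aemeasurable_remainder (hT : ∀ N, AEMeasurable (estimator T X N) P)
    (hint : ∀ t : ℤ, AEMeasurable (fun ω => psi (lagVector X m t ω)) P) (N : ℕ) :
    AEMeasurable (remainder T F psi X N) P :=
  ((hT N).sub_const _).sub ((aemeasurable_sum_lagVector hint _).fun_const_smul _)

/-- The joint limit of the scaled error and the self-normalizer: the functional central limit
theorem gives it for the partial sum path, and the remainders vanish by Slutsky's theorem. -/
theorem tendstoInDistribution_errorPair [IsProbabilityMeasure P] [IsProbabilityMeasure Q]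
    (hT : ∀ N, AEMeasurable (estimator T X N) P)
    (hint : ∀ t : ℤ, AEMeasurable (fun ω => psi (lagVector X m t ω)) P)
    {B : Fin q → ℝ≥0 → Ω' → ℝ} (hB : IsBrownianVector B Q) (Δ : Matrix (Fin q) (Fin q) ℝ)
    (hfclt : TendstoInDistribution (partialSumPath psi X) atTop (limitPath Δ B) (fun _ => P) Q)
    (hR : TendstoInMeasure P (fun (N : ℕ) ω => √(N : ℝ) • remainder T F psi X N ω) atTop
      (fun _ => 0))
    (hRsum : TendstoInMeasure P (remainderMeanSq T F psi X) atTop (fun _ => 0)) :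
    TendstoInDistribution (errorPair T F X) atTop
      (fun ω => (Δ.mulVec (brownianVec B 1 ω), fun i j => (Δ * bridgeGram B ω * Δ.transpose) i j))
      (fun _ => P) Q := by
  have hlimeq : (fun ω => SkorokhodSpace.endGram (limitPath Δ B ω)) =ᵐ[Q] fun ω =>
      (Δ.mulVec (brownianVec B 1 ω),
        fun i j => (Δ * bridgeGram B ω * Δ.transpose) i j) := by
    filter_upwards [hB.ae_continuous] with ω hω using endGram_limitPath Δ hω
  have hlimm : AEMeasurable (fun ω => (Δ.mulVec (brownianVec B 1 ω),
      fun i j => (Δ * bridgeGram B ω * Δ.transpose) i j)) Q := by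
    refine AEMeasurable.prodMk (aemeasurable_pi_lambda _ fun i => ?_)
      (aemeasurable_pi_lambda _ fun i => aemeasurable_pi_lambda _ fun j => ?_)
    · simp only [Matrix.mulVec, dotProduct]
      exact Finset.aemeasurable_fun_sum _ fun k _ => (hB.aemeasurable k _).const_mul _
    · simp only [Matrix.mul_apply]
      exact Finset.aemeasurable_fun_sum _ fun l _ => (Finset.aemeasurable_fun_sum _ fun k _ =>
        (hB.aemeasurable_bridgeGram k l).const_mul _).mul_const _
  set Y : ℕ → Ω → (Fin q → ℝ) × (Fin q → Fin q → ℝ) :=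
    fun N ω => SkorokhodSpace.gridEndGram N (partialSumPath psi X N ω) with hY
  have hYm : ∀ N, AEMeasurable (Y N) P := aemeasurable_gridEndGram_partialSumPath hint
  have hYlim : TendstoInDistribution Y atTop (fun ω => (Δ.mulVec (brownianVec B 1 ω),
      fun i j => (Δ * bridgeGram B ω * Δ.transpose) i j)) (fun _ => P) Q := by
    refine (hfclt.comp_of_tendsto_prod (h := SkorokhodSpace.gridEndGram)
      (g := SkorokhodSpace.endGram) hYm (hlimm.congr hlimeq.symm) ?_).congr
      (fun _ => EventuallyEq.rfl) hlimeq
    filter_upwards [hB.ae_continuous] with ω hω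
    exact SkorokhodSpace.tendsto_gridEndGram (limitPath_toFun Δ hω).2
  -- The linearization error is dominated by a continuous function of `Y` and of two variables
  -- that vanish in probability.
  have hRm : ∀ N : ℕ, AEMeasurable (remainder T F psi X N) P := aemeasurable_remainder hT hint
  set u : ℕ → Ω → ℝ := fun N ω => ‖√(N : ℝ) • remainder T F psi X N ω‖ with hu
  have hum : ∀ N, AEMeasurable (u N) P := fun N => ((hRm N).fun_const_smul _).norm
  have hulim : TendstoInMeasure P u atTop fun _ => 0 := by
    rw [tendstoInMeasure_iff_norm] at hR ⊢
    simpa [hu] using hR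
  have ham : ∀ N, AEMeasurable (remainderMeanSq T F psi X N) P := fun N =>
    (Finset.aemeasurable_fun_sum _ fun t _ =>
      (((hRm t).fun_const_smul _).norm.pow_const _)).const_mul _
  have hpair := (hYlim.prodMk_of_tendstoInMeasure_const _ u _ hulim
    hum).prodMk_of_tendstoInMeasure_const _ (remainderMeanSq T F psi X) _ hRsum ham
  have hbound := hpair.continuous_comp
    (g := fun x : (((Fin q → ℝ) × (Fin q → Fin q → ℝ)) × ℝ) × ℝ =>
      linearizationBound (x.1.1, (x.1.2, x.2)))
    (continuous_linearizationBound.comp (by fun_prop))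
  have hzero : ∀ y : (Fin q → ℝ) × (Fin q → Fin q → ℝ), linearizationBound (y, (0, 0)) = 0 := by
    intro y; simp [linearizationBound]
  have hbound0 : TendstoInMeasure P (fun N ω =>
      linearizationBound (Y N ω, (u N ω, remainderMeanSq T F psi X N ω))) atTop fun _ => 0 := by
    refine TendstoInDistribution.tendstoInMeasure_const (Ω' := Ω') (Q := Q) ?_
    exact hbound.congr (fun _ => EventuallyEq.rfl) (Eventually.of_forall fun ω => hzero _)
  refine tendstoInDistribution_of_tendstoInMeasure_sub _ _ hYlim ?_ (aemeasurable_errorPair hT)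
  rw [tendstoInMeasure_iff_norm] at hbound0 ⊢
  intro ε hε
  refine tendsto_of_tendsto_of_tendsto_of_le_of_le' tendsto_const_nhds (hbound0 ε hε)
    (Eventually.of_forall fun _ => zero_le) ?_
  filter_upwards [eventually_gt_atTop 0] with N hN
  refine measure_mono fun ω (hω : ε ≤ _) => ?_
  simp only [Pi.sub_apply, Pi.zero_apply, sub_zero] at hω
  have h1 := norm_errorPair_sub_le T F psi X hN ω
  simp only [mem_ofPred_eq, sub_zero]
  exact (hω.trans h1).trans (le_abs_self _)

end Convergence

/-! ### Convergence of the statistic and coverage of the confidence regions -/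

theorem theorem1 {Ω : Type*} [MeasurableSpace Ω] (P : Measure Ω) [IsProbabilityMeasure P]
    {Ω' : Type*} [MeasurableSpace Ω'] (Q : Measure Ω') [IsProbabilityMeasure Q]
    (m q : ℕ) (hq : 0 < q)
    -- the time series, the functional, its estimators and its influence function
    (X : ℤ → Ω → ℝ) (hX : IsStrictlyStationary X P)
    (T : Measure (Fin m → ℝ) → EuclideanSpace ℝ (Fin q))
    (hT : ∀ N, AEMeasurable (estimator T X N) P)
    (psi : (Fin m → ℝ) → EuclideanSpace ℝ (Fin q))
    (hpsi : IsInfluenceFunction T (marginalLaw X m P) psi)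
    -- the influence function is centred and satisfies the functional central limit theorem
    (hint : ∀ t : ℤ, Integrable (fun ω => psi (lagVector X m t ω)) P)
    (hmean : ∀ t : ℤ, ∫ ω, psi (lagVector X m t ω) ∂P = 0)
    (B : Fin q → ℝ≥0 → Ω' → ℝ) (hB : IsBrownianVector B Q)
    (Δ : Matrix (Fin q) (Fin q) ℝ) (hlow : ∀ i j, i < j → Δ i j = 0) (hdiag : ∀ i, 0 ≤ Δ i i)
    (hpos : (Δ * Δ.transpose).PosDef)
    (hfclt : TendstoInDistribution (partialSumPath psi X) atTop (limitPath Δ B) (fun _ => P) Q)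
    -- the remainder is negligible
    (hR : TendstoInMeasure P
      (fun (N : ℕ) ω => √(N : ℝ) • remainder T (marginalLaw X m P) psi X N ω) atTop
      (fun _ => 0))
    (hRsum : TendstoInMeasure P
      (fun (N : ℕ) ω => ((N : ℝ) ^ 2)⁻¹ *
        ∑ t ∈ Finset.Icc 1 N, ‖(t : ℝ) • remainder T (marginalLaw X m P) psi X t ω‖ ^ 2) atTop
      (fun _ => 0)) :
    -- the inverses in the limit and in the statistic exist (in the limit)
    (∀ᵐ ω ∂Q, IsUnit (bridgeGram B ω).det) ∧
    Tendsto (fun N => P.real {ω | IsUnit (selfNormalizer T X N ω).det}) atTop (𝓝 1) ∧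
    -- convergence in distribution of the self-normalized statistic
    TendstoInDistribution (snStatistic T X (T (marginalLaw X m P))) atTop (pivot B)
      (fun _ => P) Q ∧
    -- asymptotic validity of the confidence regions
    ∀ α : ℝ, 0 < α → α < 1 →
      Tendsto (fun N => P.real {ω | T (marginalLaw X m P) ∈
          confidenceRegion T X (percentile (Q.map (pivot B)) (1 - α)) N ω})
        atTop (𝓝 (1 - α)) := by
  -- `Δ` is invertible because `Δ Δ'` is.
  have hΔ : IsUnit Δ.det := by
    have h1 := (Matrix.isUnit_iff_isUnit_det _).1 hpos.isUnit
    rw [Matrix.det_mul] at h1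
    exact isUnit_of_mul_isUnit_left h1
  have hV : ∀ᵐ ω ∂Q, IsUnit (bridgeGram B ω).det := by
    filter_upwards [hB.ae_posDef_bridgeGram] with ω hω
    exact (Matrix.isUnit_iff_isUnit_det _).1 hω.isUnit
  have hE := tendstoInDistribution_errorPair hT (fun t => (hint t).aemeasurable) hB Δ hfclt hR
    hRsum
  have hdetZ : ∀ᵐ ω ∂Q,
      (Matrix.of fun i j => (Δ * bridgeGram B ω * Δ.transpose) i j).det ≠ 0 := by
    filter_upwards [hV] with ω hω
    have h1 : (Matrix.of fun i j => (Δ * bridgeGram B ω * Δ.transpose) i j) =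
        Δ * bridgeGram B ω * Δ.transpose := rfl
    rw [h1, Matrix.det_mul, Matrix.det_mul, Matrix.det_transpose]
    exact mul_ne_zero (mul_ne_zero hΔ.ne_zero hω.ne_zero) hΔ.ne_zero
  have hstat : TendstoInDistribution (snStatistic T X (T (marginalLaw X m P))) atTop (pivot B)
      (fun _ => P) Q := by
    refine (hE.comp_of_continuousAt measurable_invQuad ?_).congr
      (fun N => Eventually.of_forall fun ω => (snStatistic_eq_invQuad T _ X N ω).symm)
      (Eventually.of_forall fun ω => ?_)
    · filter_upwards [hdetZ] with ω hω using continuousAt_invQuad hω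
    · rw [invQuad_mulVec_conj hΔ, pivot_eq_invQuad]
  refine ⟨hV, ?_, hstat, fun α hα0 hα1 => ?_⟩
  · have hcl : IsClosed {p : (Fin q → ℝ) × (Fin q → Fin q → ℝ) | (Matrix.of p.2).det = 0} :=
      isClosed_eq (continuous_det_of.comp continuous_snd) continuous_const
    have h0 := tendsto_measure_preimage_zero hE hcl
      ((measure_eq_zero_iff_ae_notMem).2 hdetZ)
    have h1 := (ENNReal.tendsto_toReal ENNReal.zero_ne_top).comp h0
    have h2 := h1.const_sub 1
    rw [ENNReal.toReal_zero, sub_zero] at h2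
    refine h2.congr fun N => ?_
    have hset : {ω | IsUnit (selfNormalizer T X N ω).det} =
        (errorPair T (marginalLaw X m P) X N ⁻¹' {p | (Matrix.of p.2).det = 0})ᶜ := by
      ext ω
      exact isUnit_iff_ne_zero
    rw [hset, measureReal_compl₀
      ((hE.forall_aemeasurable N).nullMeasurableSet_preimage hcl.measurableSet)]
    simp [measureReal_def]
  · have hatom := hB.nullSingletonClass_pivot hq
    have : IsProbabilityMeasure (Q.map (pivot B)) :=
      Measure.isProbabilityMeasure_map hB.aemeasurable_pivot
    set c := percentile (Q.map (pivot B)) (1 - α) with hc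
    have h1 := ProbabilityMeasure.tendsto_measure_of_null_frontier_of_tendsto' hstat.tendsto
      (E := Iic c) (by
        rw [frontier_Iic]
        simp)
    have h2 := (ENNReal.tendsto_toReal (measure_ne_top (Q.map (pivot B)) _)).comp h1
    have h3 := measureReal_Iic_percentile (Q.map (pivot B)) (p := 1 - α) (by linarith)
      (by linarith)
    rw [← h3]
    refine h2.congr fun N => ?_
    simp only [Function.comp_apply, ProbabilityMeasure.coe_mk]
    rw [Measure.map_apply_of_aemeasurable (hstat.forall_aemeasurable N) measurableSet_Iic]
    rfl
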